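/- Let $M$ be a smooth finite-dimensional (Hausdorff) manifold, $H\subseteq TM$ a smooth vector subbundle, $I=[a,b]$ with $a<b$, and $\beta_0:I\to M$ a smooth path tangent to $H$, i.e. $\dot\beta_0(t)\in H_{\beta_0(t)}$ for all $t\in I$. Let $P^H:TM\to TM/H$ be the canonical projection, and let $C^H_p: H_p\wedge H_p\to T_pM/H_p$ be the curvature tensor of $H$, $C^H_p(X_p\wedge Y_p)=P^H_p[X,Y]_p$ for smooth sections $X,Y$ of $H$. For a smooth vector subbundle $K$ of $TM$ supplementary to $H$ (that is, $T_pM=H_p\oplus K_p$ for all $p\in M$), let $P^K_H$ be the projection of $TM$ onto $H$ along $K$, and $Q^H_K:TM/H\to K$ the canonical isomorphism. Let $\omega$ be the canonical involution of $T(TM)$ (in induced charts $(x,y;u,w)\mapsto(x,u;y,w)$). The bundle $\beta_0^*K\to I$ carries the linear connection whose horizontal subspace at $(t,k)$ is the inverse image of $T_kK\cap\omega(TH)$ under the tangent map of the canonical map $\beta_0^*K\to K$ (here $H,K$ also denote the total spaces, as submanifolds of $TM$). Let $(\beta_0^*K)_s^t:K_{\beta_0(s)}\to K_{\beta_0(t)}$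 be its parallel transport, which is well defined for all $s,t\in I$ (there is a unique parallel section of $\beta_0^*K$ over $I$ with a given value at $s$), and let $$[\beta_0^*K]_s^t=(Q^{H}_{K})_{\beta_0(t)}^{-1}\,(\beta_0^*K)_s^t\,(Q^{H}_{K})_{\beta_0(s)}:\ T_{\beta_0(s)}M/H_{\beta_0(s)}\to T_{\beta_0(t)}M/H_{\beta_0(t)} .$$ Then, for every such $K$, every $t_0\in I$ and every smooth section $X$ of $\beta_0^*(TM)$, the derivative in $$(\mathsf D X)_t=[\beta_0^*K]_{t_0}^t\,\frac{d}{dt}\Big([\beta_0^*K]_t^{t_0}P^H X_t\Big)-C^H_{\beta_0(t)}\big(P^K_H X_t\wedge\dot\beta_0(t)\big),\qquad t\in I,$$ exists, and $\mathsf D X$ is a smooth section of $\beta_0^*(TM/H)$; so $\mathsf D$ maps $C^\infty\Gamma(\beta_0^*(TM))$ to $C^\infty\Gamma(\beta_0^*(TM/H))$. The operator $\mathsf D$ depends neither on $t_0\in I$ nor on the smooth subbundle $K$ supplementary to $H$. -/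

import Mathlib

open Set Filter Topology
open scoped Manifold ContDiff

noncomputable section

namespace SubbundleCurvature

variable {E : Type*} [NormedAddCommGroup E] [NormedSpace ℝ E]
  {M : Type*} [TopologicalSpace M] [ChartedSpace E M] [IsManifold 𝓘(ℝ, E) ∞ M]

section Subbundles

/-- A family of subspaces `H p ⊆ T_p M` is a smooth vector subbundle of `TM` if near every point it
is spanned by smooth, pointwise linearly independent vector fields. -/
def IsSmoothSubbundle (H : ∀ p : M, Submodule ℝ (TangentSpace 𝓘(ℝ, E) p)) : Prop :=
  ∀ p₀ : M, ∃ (k : ℕ) (e : Fin k → ∀ p : M, TangentSpace 𝓘(ℝ, E) p), ∃ U ∈ 𝓝 p₀,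
    (∀ i, ContMDiffOn 𝓘(ℝ, E) (𝓘(ℝ, E).tangent) ∞
      (fun p => (⟨p, e i p⟩ : TangentBundle 𝓘(ℝ, E) M)) U) ∧
    ∀ p ∈ U, LinearIndependent ℝ (fun i => e i p) ∧
      Submodule.span ℝ (Set.range fun i => e i p) = H p

/-- `X` is a globally defined smooth section of the subbundle `H`. -/
def IsSmoothSectionOf (H : ∀ p : M, Submodule ℝ (TangentSpace 𝓘(ℝ, E) p))
    (X : ∀ p : M, TangentSpace 𝓘(ℝ, E) p) : Prop :=
  ContMDiff 𝓘(ℝ, E) (𝓘(ℝ, E).tangent) ∞ (fun p => (⟨p, X p⟩ : TangentBundle 𝓘(ℝ, E) M)) ∧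
    ∀ p, X p ∈ H p

open Classical in
/-- The curvature tensor of `H` at `p`, evaluated on `u ∧ v` with `u, v ∈ H p`: the class
in `T_p M / H_p` of `[X, Y]_p`, where `X`, `Y` are smooth sections of `H` with `X_p = u`, `Y_p = v`.
(Only used for `u, v ∈ H p`; the class does not depend on the choice of `X` and `Y`.) -/
def curvature (H : ∀ p : M, Submodule ℝ (TangentSpace 𝓘(ℝ, E) p)) (p : M)
    (u v : TangentSpace 𝓘(ℝ, E) p) : TangentSpace 𝓘(ℝ, E) p ⧸ H p :=
  if h : ∃ XY : (∀ q : M, TangentSpace 𝓘(ℝ, E) q) × (∀ q : M, TangentSpace 𝓘(ℝ, E) q),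
      IsSmoothSectionOf H XY.1 ∧ IsSmoothSectionOf H XY.2 ∧ XY.1 p = u ∧ XY.2 p = v then
    (H p).mkQ (VectorField.mlieBracket 𝓘(ℝ, E) h.choose.1 h.choose.2 p)
  else 0

/-- The total space of `H`, as a subset of `TM`. -/
def totalSet (H : ∀ p : M, Submodule ℝ (TangentSpace 𝓘(ℝ, E) p)) :
    Set (TangentBundle 𝓘(ℝ, E) M) :=
  {v | v.2 ∈ H v.1}

end Subbundles

section SecondTangent

/-- The tangent bundle `T(TM)` of the manifold `TM`. -/
abbrev SecondTangentBundle (E : Type*) [NormedAddCommGroup E] [NormedSpace ℝ E]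
    (M : Type*) [TopologicalSpace M] [ChartedSpace E M] [IsManifold 𝓘(ℝ, E) ∞ M] :=
  TangentBundle (𝓘(ℝ, E).tangent) (TangentBundle 𝓘(ℝ, E) M)

/-- The canonical involution `ω` of `T(TM)`, given in the chart of `T(TM)` induced by any chart
of `M` by `(x, y; u, w) ↦ (x, u; y, w)`. A vector tangent to `TM` at `(p, y)` is by definition
represented by a pair `(u, w)` in the chart of `TM` induced by the preferred chart of `M` at `p`,
in which moreover the fibre coordinate on `T_p M` is the identity; so the formula below
is the above one, read in that chart. -/
def canonicalFlip (W : SecondTangentBundle E M) : SecondTangentBundle E M :=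
  ⟨⟨W.proj.proj, (show E × E from W.snd).1⟩,
    (show E × E from (show E from W.proj.snd, (show E × E from W.snd).2))⟩

/-- The tangent vectors of a submanifold `S` of `TM`, as a subset of `T(TM)`: the velocities of the
smooth curves in `TM` that stay in `S`. -/
def tangentsTo (S : Set (TangentBundle 𝓘(ℝ, E) M)) : Set (SecondTangentBundle E M) :=
  {W | ∃ γ : ℝ → TangentBundle 𝓘(ℝ, E) M,
    ContMDiffAt 𝓘(ℝ, ℝ) (𝓘(ℝ, E).tangent) ∞ γ 0 ∧ (∀ᶠ s in 𝓝 (0 : ℝ), γ s ∈ S) ∧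
    W = tangentMap 𝓘(ℝ, ℝ) (𝓘(ℝ, E).tangent) γ ⟨0, (1 : ℝ)⟩}

end SecondTangent

section AlongCurve

/-- The velocity at `t` of a curve defined on `J ⊆ ℝ`. -/
def velocity (β : ℝ → M) (J : Set ℝ) (t : ℝ) : TangentSpace 𝓘(ℝ, E) (β t) :=
  mfderivWithin 𝓘(ℝ, ℝ) 𝓘(ℝ, E) β J t (1 : ℝ)

/-- `X` is a smooth section of `β^* TM` over `J`. -/
def IsSmoothAlong (β : ℝ → M) (J : Set ℝ) (X : ∀ t : ℝ, TangentSpace 𝓘(ℝ, E) (β t)) : Prop :=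
  ContMDiffOn 𝓘(ℝ, ℝ) (𝓘(ℝ, E).tangent) ∞
    (fun t => (⟨β t, X t⟩ : TangentBundle 𝓘(ℝ, E) M)) J

/-- `Y` is a smooth section of `β^* (TM/H)` over `J`: locally it is the projection of a smooth
section of `β^* TM`. -/
def IsSmoothQuotientAlong (H : ∀ p : M, Submodule ℝ (TangentSpace 𝓘(ℝ, E) p)) (β : ℝ → M)
    (J : Set ℝ) (Y : ∀ t : ℝ, TangentSpace 𝓘(ℝ, E) (β t) ⧸ H (β t)) : Prop :=
  ∀ t₀ ∈ J, ∃ U ∈ 𝓝 t₀, ∃ Z : ∀ t : ℝ, TangentSpace 𝓘(ℝ, E) (β t),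
    IsSmoothAlong β (J ∩ U) Z ∧ ∀ t ∈ J ∩ U, (H (β t)).mkQ (Z t) = Y t

end AlongCurve

section Transport

variable (H K : ∀ p : M, Submodule ℝ (TangentSpace 𝓘(ℝ, E) p))

/-- `σ` is a parallel section over `J` of `β^* K`, for the linear connection on `β^* K` whose
horizontal subspace at `k` consists of the vectors that are mapped to `T_k K ∩ ω(TH)` by the tangent
map of `β^* K → K` (`β` is tangent to `H`). -/
def IsParallel (β : ℝ → M) (J : Set ℝ) (σ : ∀ t : ℝ, K (β t)) : Prop :=
  MDifferentiableOn 𝓘(ℝ, ℝ) (𝓘(ℝ, E).tangent)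
      (fun t => (⟨β t, (σ t : TangentSpace 𝓘(ℝ, E) (β t))⟩ : TangentBundle 𝓘(ℝ, E) M)) J ∧
    ∀ t ∈ J,
      tangentMapWithin 𝓘(ℝ, ℝ) (𝓘(ℝ, E).tangent)
        (fun t => (⟨β t, (σ t : TangentSpace 𝓘(ℝ, E) (β t))⟩ : TangentBundle 𝓘(ℝ, E) M)) J
        ⟨t, (1 : ℝ)⟩ ∈ tangentsTo (totalSet K) ∩ canonicalFlip '' tangentsTo (totalSet H)

open Classical in
/-- The parallel transport `(β^* K)_s^t : K_{β(s)} → K_{β(t)}`: it maps `k` to the value at `t` of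
the parallel section with value `k` at `s`. -/
def parallelTransport (β : ℝ → M) (J : Set ℝ) (s t : ℝ) (k : K (β s)) : K (β t) :=
  if h : ∃ σ : ∀ r : ℝ, K (β r), IsParallel H K β J σ ∧ σ s = k then h.choose t else 0

variable {H K}

/-- The operator `[β^* K]_s^t : T_{β(s)}M / H_{β(s)} → T_{β(t)}M / H_{β(t)}` induced by the
parallel transport through the canonical isomorphisms `T_p M / H_p ≃ K_p`. -/
def quotientTransport (hHK : ∀ p, IsCompl (H p) (K p)) (β : ℝ → M) (J : Set ℝ) (s t : ℝ)
    (v : TangentSpace 𝓘(ℝ, E) (β s) ⧸ H (β s)) : TangentSpace 𝓘(ℝ, E) (β t) ⧸ H (β t) :=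
  ((H (β t)).quotientEquivOfIsCompl (K (β t)) (hHK (β t))).symm
    (parallelTransport H K β J s t
      ((H (β s)).quotientEquivOfIsCompl (K (β s)) (hHK (β s)) v))

/-- The curve `t ↦ [β^* K]_t^{t₀} P^H X_t` in the fixed vector space `T_{β(t₀)}M / H_{β(t₀)}`. -/
def transportedClass (hHK : ∀ p, IsCompl (H p) (K p)) (β : ℝ → M) (J : Set ℝ) (t₀ : ℝ)
    (X : ∀ t : ℝ, TangentSpace 𝓘(ℝ, E) (β t)) (t : ℝ) :
    TangentSpace 𝓘(ℝ, E) (β t₀) ⧸ H (β t₀) :=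
  quotientTransport hHK β J t t₀ ((H (β t)).mkQ (X t))

/-- `(D X)_t = [β^* K]_{t₀}^t d/dt ([β^* K]_t^{t₀} P^H X_t) - C^H (P^K_H X_t ∧ β'(t))`, computed with
the complement `K` and the base point `t₀`; `P^K_H` is the projection onto `H` along `K`. -/
def variationOperator (hHK : ∀ p, IsCompl (H p) (K p)) (β : ℝ → M) (J : Set ℝ) (t₀ : ℝ)
    (X : ∀ t : ℝ, TangentSpace 𝓘(ℝ, E) (β t)) (t : ℝ) :
    TangentSpace 𝓘(ℝ, E) (β t) ⧸ H (β t) :=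
  quotientTransport hHK β J t₀ t (derivWithin (transportedClass hHK β J t₀ X) J t) -
    curvature H (β t) ((H (β t)).projection (K (β t)) (hHK (β t)) (X t)) (velocity β J t)

end Transport

end SubbundleCurvature

end

/-! In a chart of `M`, let `π x` be the projection onto `K` along `H`, so that `H = ker π` and `K =
ker (1 - π)`. Everything is expressed through `π` and its derivative `Dπ`.

Linearising these equations gives the tangent spaces of the total spaces of `H` and `K`
(`mem_tangentsTo_iff`), and the canonical involution exchanges the base velocity with the fibre
coordinate. Hence, for a curve with velocity `v` in `H`, a section `y` of `K` is parallel iff `y' =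
Dπ(v) y - Dπ(y) v` (`IsProjectionChart.isParallelAt_iff`). This linear equation preserves `K`, so it
has unique local solutions, which are patched over the compact interval.

Differentiating `π X = 0` for sections `X` of `H` shows that the curvature of `u ∧ v` is the class
of `Dπ(v) u - Dπ(u) v` (`curvature_eq`). If `ξ` represents `X` along the curve, the covariant
derivative of its class is that of `π ξ' + Dπ(v) ξ - Dπ(v) π ξ + Dπ(π ξ) v`. Subtracting the
curvature of `(1 - π) ξ ∧ v` cancels every derivative of `π` in the direction `v`, and `D X` is the
class of `ξ' + Dπ(ξ) v` (`variationOperator_eq`). This is smooth and free of `t₀`.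

If `π₁`, `π₂` are projections with the same kernel `H`, then `π₂ π₁ = π₂`. Differentiating in the
direction `u` and applying the result to `v ∈ H`, where `π₁ v = 0`, gives `π₂ Dπ₁(u) v = Dπ₂(u) v`
(`IsKernelChart.apply_fderiv_eq`). So `Dπ(ξ) v` modulo `H` does not depend on `K`. -/

noncomputable section

namespace SubbundleCurvature

/-! ### Charts of `TM` and coordinates on `T(TM)` -/

section

variable {E : Type*} [NormedAddCommGroup E] [NormedSpace ℝ E]
  {M : Type*} [TopologicalSpace M] [ChartedSpace E M] [IsManifold 𝓘(ℝ, E) ∞ M]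

/-- The fibre coordinate on `T_p M` induced by the preferred chart at `p₀`. -/
def fibreCoord (p₀ p : M) : TangentSpace 𝓘(ℝ, E) p →L[ℝ] E :=
  (trivializationAt E (TangentSpace 𝓘(ℝ, E)) p₀).continuousLinearMapAt ℝ p

/-- The inverse of `fibreCoord`. -/
def fibreCoordSymm (p₀ p : M) : E →L[ℝ] TangentSpace 𝓘(ℝ, E) p :=
  (trivializationAt E (TangentSpace 𝓘(ℝ, E)) p₀).symmL ℝ p

/-- The chart of `TM` induced by the preferred chart of `M` at `p₀`. -/
def tangentCoord (p₀ : M) (v : TangentBundle 𝓘(ℝ, E) M) : E × E :=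
  (extChartAt 𝓘(ℝ, E) p₀ v.1, fibreCoord p₀ v.1 v.2)

/-- The inverse of `tangentCoord`. -/
def tangentCoordSymm (p₀ : M) (z : E × E) : TangentBundle 𝓘(ℝ, E) M :=
  ⟨(extChartAt 𝓘(ℝ, E) p₀).symm z.1, fibreCoordSymm p₀ _ z.2⟩

theorem fibreCoord_fibreCoordSymm {p₀ p : M} (hp : p ∈ (chartAt E p₀).source) (v : E) :
    fibreCoord p₀ p (fibreCoordSymm p₀ p v) = v :=
  (trivializationAt E (TangentSpace 𝓘(ℝ, E)) p₀).continuousLinearMapAt_symmL (by simpa using hp) v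

theorem fibreCoordSymm_fibreCoord {p₀ p : M} (hp : p ∈ (chartAt E p₀).source)
    (v : TangentSpace 𝓘(ℝ, E) p) :
    fibreCoordSymm p₀ p (fibreCoord p₀ p v) = v :=
  (trivializationAt E (TangentSpace 𝓘(ℝ, E)) p₀).symmL_continuousLinearMapAt (by simpa using hp) v

theorem fibreCoord_injective {p₀ p : M} (hp : p ∈ (chartAt E p₀).source) :
    Function.Injective (fibreCoord (E := E) p₀ p) :=
  Function.LeftInverse.injective (fibreCoordSymm_fibreCoord hp)

theorem fibreCoord_eq_mfderiv {p₀ p : M} (hp : p ∈ (chartAt E p₀).source) :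
    fibreCoord p₀ p = mfderiv 𝓘(ℝ, E) 𝓘(ℝ, E) (extChartAt 𝓘(ℝ, E) p₀) p :=
  TangentBundle.continuousLinearMapAt_trivializationAt hp

theorem fibreCoord_eq_snd {p₀ p : M} (hp : p ∈ (chartAt E p₀).source)
    (v : TangentSpace 𝓘(ℝ, E) p) :
    fibreCoord p₀ p v = (trivializationAt E (TangentSpace 𝓘(ℝ, E)) p₀ ⟨p, v⟩).2 := by
  have := (trivializationAt E (TangentSpace 𝓘(ℝ, E)) p₀).coe_linearMapAt_of_mem (R := ℝ)
    (b := p) (by simpa using hp)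
  exact congrFun this v

theorem fibreCoord_self (p : M) (v : TangentSpace 𝓘(ℝ, E) p) :
    fibreCoord p p v = v := by
  rw [fibreCoord_eq_mfderiv (mem_chart_source E p), mfderiv_extChartAt_self]
  rfl

theorem extChartAt_tangent_apply {v₀ v : TangentBundle 𝓘(ℝ, E) M}
    (hv : v.1 ∈ (chartAt E v₀.1).source) :
    extChartAt 𝓘(ℝ, E).tangent v₀ v = tangentCoord v₀.1 v := by
  rw [FiberBundle.extChartAt, tangentCoord, fibreCoord_eq_snd hv]
  rfl

theorem extChartAt_tangent_symm_apply {v₀ : TangentBundle 𝓘(ℝ, E) M} {z : E × E}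
    (hz : z.1 ∈ (extChartAt 𝓘(ℝ, E) v₀.1).target) :
    (extChartAt 𝓘(ℝ, E).tangent v₀).symm z = tangentCoordSymm v₀.1 z := by
  have hs : (extChartAt 𝓘(ℝ, E) v₀.1).symm z.1 ∈ (chartAt E v₀.1).source := by
    simpa using (extChartAt 𝓘(ℝ, E) v₀.1).map_target hz
  have h1 : tangentCoordSymm v₀.1 z ∈ (extChartAt 𝓘(ℝ, E).tangent v₀).source := by
    simpa [tangentCoordSymm] using hs
  have h2 : extChartAt 𝓘(ℝ, E).tangent v₀ (tangentCoordSymm v₀.1 z) = z := by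
    rw [extChartAt_tangent_apply hs]
    exact Prod.ext ((extChartAt 𝓘(ℝ, E) v₀.1).right_inv hz) (fibreCoord_fibreCoordSymm hs _)
  conv_lhs => rw [← h2]
  exact (extChartAt 𝓘(ℝ, E).tangent v₀).left_inv h1

theorem tangentCoordSymm_tangentCoord {p₀ : M} {v : TangentBundle 𝓘(ℝ, E) M}
    (hv : v.1 ∈ (chartAt E p₀).source) : tangentCoordSymm p₀ (tangentCoord p₀ v) = v := by
  rw [← extChartAt_tangent_apply (v₀ := ⟨p₀, 0⟩) hv,
    ← extChartAt_tangent_symm_apply (v₀ := ⟨p₀, 0⟩)]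
  · exact (extChartAt 𝓘(ℝ, E).tangent _).left_inv (by simpa using hv)
  · rw [extChartAt_tangent_apply hv]
    exact (extChartAt 𝓘(ℝ, E) p₀).map_source (by simpa using hv)

theorem tangentCoord_tangentCoordSymm {p₀ : M} {z : E × E}
    (hz : z.1 ∈ (extChartAt 𝓘(ℝ, E) p₀).target) :
    tangentCoord p₀ (tangentCoordSymm p₀ z) = z := by
  have hs : (extChartAt 𝓘(ℝ, E) p₀).symm z.1 ∈ (chartAt E p₀).source := by
    simpa using (extChartAt 𝓘(ℝ, E) p₀).map_target hz
  exact Prod.ext ((extChartAt 𝓘(ℝ, E) p₀).right_inv hz) (fibreCoord_fibreCoordSymm hs _)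

/-- `tangentCoord` is a globally defined formula; this transfers to it the smoothness and the
invertible derivative of a genuine chart of `TM`. -/
theorem tangentCoord_eventuallyEq {p₀ : M} {v : TangentBundle 𝓘(ℝ, E) M}
    (hv : v.1 ∈ (chartAt E p₀).source) :
    tangentCoord p₀ =ᶠ[𝓝 v] extChartAt 𝓘(ℝ, E).tangent (⟨p₀, 0⟩ : TangentBundle 𝓘(ℝ, E) M) := by
  have := extChartAt_source_mem_nhds' (I := 𝓘(ℝ, E).tangent)
    (x := (⟨p₀, 0⟩ : TangentBundle 𝓘(ℝ, E) M)) (x' := v) (by simpa using hv)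
  filter_upwards [this] with w hw
  rw [extChartAt_tangent_apply]
  simpa using hw

theorem contMDiffAt_tangentCoord {p₀ : M} {v : TangentBundle 𝓘(ℝ, E) M}
    (hv : v.1 ∈ (chartAt E p₀).source) :
    ContMDiffAt 𝓘(ℝ, E).tangent 𝓘(ℝ, E × E) ∞ (tangentCoord p₀) v :=
  (contMDiffAt_extChartAt' (by simpa using hv)).congr_of_eventuallyEq
    (tangentCoord_eventuallyEq hv)

theorem isInvertible_mfderiv_tangentCoord {p₀ : M} {v : TangentBundle 𝓘(ℝ, E) M}
    (hv : v.1 ∈ (chartAt E p₀).source) :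
    (mfderiv 𝓘(ℝ, E).tangent 𝓘(ℝ, E × E) (tangentCoord p₀) v).IsInvertible := by
  rw [(tangentCoord_eventuallyEq hv).mfderiv_eq]
  exact isInvertible_mfderiv_extChartAt (by simpa using hv)

theorem contMDiffAt_tangentCoordSymm {p₀ : M} {z : E × E}
    (hz : z.1 ∈ (extChartAt 𝓘(ℝ, E) p₀).target) :
    ContMDiffAt 𝓘(ℝ, E × E) 𝓘(ℝ, E).tangent ∞ (tangentCoordSymm p₀) z := by
  have ho : IsOpen ((extChartAt 𝓘(ℝ, E) p₀).target ×ˢ (univ : Set E)) :=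
    (isOpen_extChartAt_target p₀).prod isOpen_univ
  have hm : z ∈ (extChartAt 𝓘(ℝ, E).tangent (⟨p₀, 0⟩ : TangentBundle 𝓘(ℝ, E) M)).target := by
    rw [FiberBundle.extChartAt_target]
    exact ⟨⟨hz, by simpa using (extChartAt 𝓘(ℝ, E) p₀).map_target hz⟩, mem_univ _⟩
  refine ((contMDiffOn_extChartAt_symm (I := 𝓘(ℝ, E).tangent)
    (⟨p₀, 0⟩ : TangentBundle 𝓘(ℝ, E) M)).contMDiffAt
    ((isOpen_extChartAt_target _).mem_nhds hm)).congr_of_eventuallyEq ?_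
  filter_upwards [ho.mem_nhds ⟨hz, mem_univ _⟩] with w hw
  rw [extChartAt_tangent_symm_apply (v₀ := ⟨p₀, 0⟩) hw.1]

/-- The coordinates of a vector tangent to `TM`, in the chart of `T(TM)` induced by the preferred
chart of `M` at `p₀`. -/
def secondCoord (p₀ : M) (W : SecondTangentBundle E M) : E × E :=
  mfderiv 𝓘(ℝ, E).tangent 𝓘(ℝ, E × E) (tangentCoord p₀) W.proj W.snd

theorem secondTangent_ext {p₀ : M} {v : TangentBundle 𝓘(ℝ, E) M}
    (hv : v.1 ∈ (chartAt E p₀).source) {w w' : TangentSpace 𝓘(ℝ, E).tangent v}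
    (h : secondCoord p₀ ⟨v, w⟩ = secondCoord p₀ ⟨v, w'⟩) : w = w' :=
  (isInvertible_mfderiv_tangentCoord hv).injective h

end

/-! ### The canonical involution in an arbitrary chart -/

section

variable {E : Type*} [NormedAddCommGroup E] [NormedSpace ℝ E]
  {M : Type*} [TopologicalSpace M] [ChartedSpace E M] [IsManifold 𝓘(ℝ, E) ∞ M]

/-- Chain rule: fibre coordinates are tangent maps of charts, so passing from one to another is the
derivative of the transition map. -/
theorem fibreCoord_comp_fibreCoordSymm {p₀ p q : M} (hp : q ∈ (chartAt E p).source)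
    (hp₀ : q ∈ (chartAt E p₀).source) (w : E) :
    fibreCoord p₀ q (fibreCoordSymm p q w) =
      fderiv ℝ (extChartAt 𝓘(ℝ, E) p₀ ∘ (extChartAt 𝓘(ℝ, E) p).symm)
        (extChartAt 𝓘(ℝ, E) p q) w := by
  have hps : q ∈ (extChartAt 𝓘(ℝ, E) p).source := by simpa using hp
  have hq : (extChartAt 𝓘(ℝ, E) p).symm (extChartAt 𝓘(ℝ, E) p q) = q :=
    (extChartAt 𝓘(ℝ, E) p).left_inv hps
  have h1 : MDifferentiableWithinAt 𝓘(ℝ, E) 𝓘(ℝ, E) (extChartAt 𝓘(ℝ, E) p).symm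
      (range 𝓘(ℝ, E)) (extChartAt 𝓘(ℝ, E) p q) :=
    mdifferentiableWithinAt_extChartAt_symm ((extChartAt 𝓘(ℝ, E) p).map_source hps)
  have h2 : MDifferentiableAt 𝓘(ℝ, E) 𝓘(ℝ, E) (extChartAt 𝓘(ℝ, E) p₀) q :=
    mdifferentiableAt_extChartAt hp₀
  have hs : fibreCoordSymm p q w = mfderivWithin 𝓘(ℝ, E) 𝓘(ℝ, E) (extChartAt 𝓘(ℝ, E) p).symm
      (range 𝓘(ℝ, E)) (extChartAt 𝓘(ℝ, E) p q) w := by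
    rw [fibreCoordSymm, TangentBundle.symmL_trivializationAt hp]
    rfl
  rw [hs, fibreCoord_eq_mfderiv hp₀, ← mfderiv_eq_fderiv]
  have h3 := h1.hasMFDerivWithinAt
  rw [modelWithCornersSelf_coe, range_id, hasMFDerivWithinAt_univ] at h3
  have h4 := h2.hasMFDerivAt
  have h5 : HasMFDerivAt 𝓘(ℝ, E) 𝓘(ℝ, E) (extChartAt 𝓘(ℝ, E) p₀)
    ((extChartAt 𝓘(ℝ, E) p).symm (extChartAt 𝓘(ℝ, E) p q))
      (mfderiv 𝓘(ℝ, E) 𝓘(ℝ, E) (extChartAt 𝓘(ℝ, E) p₀) q) := by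
    rwa [hq]
  rw [(h5.comp _ h3).mfderiv]
  rw [modelWithCornersSelf_coe, range_id]
  rfl

theorem contDiffAt_coordChange {p₀ p : M} (hp : p ∈ (chartAt E p₀).source) :
    ContDiffAt ℝ ∞ (extChartAt 𝓘(ℝ, E) p₀ ∘ (extChartAt 𝓘(ℝ, E) p).symm)
      (extChartAt 𝓘(ℝ, E) p p) := by
  have := contDiffWithinAt_ext_coord_change (I := 𝓘(ℝ, E)) (n := ∞) p₀ p
    (y := extChartAt 𝓘(ℝ, E) p p) (by
      rw [PartialEquiv.trans_source'', PartialEquiv.symm_symm, PartialEquiv.symm_target]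
      exact mem_image_of_mem _ ⟨by simp, by simpa using hp⟩)
  rwa [modelWithCornersSelf_coe, range_id, contDiffWithinAt_univ] at this

/-- The coordinates of a vector tangent to `TM` in terms of its components. -/
theorem secondCoord_mk {p₀ p : M} (hp : p ∈ (chartAt E p₀).source)
    (y u w : E) :
    secondCoord p₀ (⟨⟨p, y⟩, ((u, w) : E × E)⟩ : SecondTangentBundle E M) =
      (fibreCoord p₀ p u,
        fderiv ℝ (fderiv ℝ (extChartAt 𝓘(ℝ, E) p₀ ∘ (extChartAt 𝓘(ℝ, E) p).symm))
          (extChartAt 𝓘(ℝ, E) p p) u y + fibreCoord p₀ p w) := by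
  set f := extChartAt 𝓘(ℝ, E) p₀ ∘ (extChartAt 𝓘(ℝ, E) p).symm with hf
  set x := extChartAt 𝓘(ℝ, E) p p with hx
  have hcd : ContDiffAt ℝ ∞ f x := contDiffAt_coordChange hp
  have hself : ∀ v : E, fibreCoord p₀ p v = fderiv ℝ f x v := by
    intro v
    rw [← fibreCoord_comp_fibreCoordSymm (mem_chart_source E p) hp]
    exact congrArg (fibreCoord p₀ p) ((fibreCoord_self p (fibreCoordSymm p p v)).symm.trans
      (fibreCoord_fibreCoordSymm (mem_chart_source E p) v)).symm
  -- The transition map of `TM` is `(x, y) ↦ (f x, Df_x y)`. Its derivative contains the second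
  -- derivative of `f`, the only term that is not tensorial.
  have hG : HasFDerivAt (fun z : E × E => (f z.1, fderiv ℝ f z.1 z.2))
      (((fderiv ℝ f x).comp (ContinuousLinearMap.fst ℝ E E)).prod
        (((fderiv ℝ f x).comp (ContinuousLinearMap.snd ℝ E E)) +
          (((fderiv ℝ (fderiv ℝ f) x).comp (ContinuousLinearMap.fst ℝ E E)).flip y)))
      (x, (y : E)) := by
    have h1 : HasFDerivAt f (fderiv ℝ f x) x :=
      (hcd.differentiableAt (by simp)).hasFDerivAt
    have h2 : HasFDerivAt (fderiv ℝ f) (fderiv ℝ (fderiv ℝ f) x) x :=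
      ((hcd.fderiv_right (m := 1) (by norm_cast)).differentiableAt (by simp)).hasFDerivAt
    have h3 : HasFDerivAt (fun z : E × E => z.1) (ContinuousLinearMap.fst ℝ E E) (x, (y : E)) :=
      hasFDerivAt_fst
    have h4 : HasFDerivAt (fun z : E × E => z.2) (ContinuousLinearMap.snd ℝ E E) (x, (y : E)) :=
      hasFDerivAt_snd
    exact (h1.comp (x, (y : E)) h3).prodMk ((h2.comp (x, (y : E)) h3).clm_apply h4)
  have hext : extChartAt 𝓘(ℝ, E).tangent (⟨p, y⟩ : TangentBundle 𝓘(ℝ, E) M) ⟨p, y⟩ = (x, y) := by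
    rw [extChartAt_tangent_apply (mem_chart_source E p), tangentCoord, fibreCoord_self]
  have hev : writtenInExtChartAt 𝓘(ℝ, E).tangent 𝓘(ℝ, E × E) (⟨p, y⟩ : TangentBundle 𝓘(ℝ, E) M)
      (tangentCoord p₀) =ᶠ[𝓝 (x, (y : E))] fun z : E × E => (f z.1, fderiv ℝ f z.1 z.2) := by
    have hopen : IsOpen ((extChartAt 𝓘(ℝ, E) p).target ∩
        (extChartAt 𝓘(ℝ, E) p).symm ⁻¹' (chartAt E p₀).source) :=
      (continuousOn_extChartAt_symm p).isOpen_inter_preimage (isOpen_extChartAt_target p)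
        (chartAt E p₀).open_source
    have hmem : x ∈ (extChartAt 𝓘(ℝ, E) p).target ∩
        (extChartAt 𝓘(ℝ, E) p).symm ⁻¹' (chartAt E p₀).source := by
      refine ⟨mem_extChartAt_target p, ?_⟩
      simpa [hx] using hp
    filter_upwards [(hopen.prod isOpen_univ).mem_nhds ⟨hmem, mem_univ (y : E)⟩] with z hz
    have hz1 : z.1 ∈ (extChartAt 𝓘(ℝ, E) p).target := hz.1.1
    have hq : (extChartAt 𝓘(ℝ, E) p).symm z.1 ∈ (chartAt E p).source := by
      simpa using (extChartAt 𝓘(ℝ, E) p).map_target hz1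
    simp only [writtenInExtChartAt, extChartAt_model_space_eq_id, PartialEquiv.refl_coe,
      Function.comp_apply, id]
    rw [extChartAt_tangent_symm_apply (v₀ := ⟨p, y⟩) hz1]
    refine Prod.ext rfl ?_
    refine (fibreCoord_comp_fibreCoordSymm hq hz.1.2 z.2).trans ?_
    rw [(extChartAt 𝓘(ℝ, E) p).right_inv hz1]
  have hmd : MDifferentiableAt 𝓘(ℝ, E).tangent 𝓘(ℝ, E × E) (tangentCoord p₀)
      (⟨p, y⟩ : TangentBundle 𝓘(ℝ, E) M) :=
    (contMDiffAt_tangentCoord hp).mdifferentiableAt (by simp)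
  have hder : mfderiv 𝓘(ℝ, E).tangent 𝓘(ℝ, E × E) (tangentCoord p₀)
      (⟨p, y⟩ : TangentBundle 𝓘(ℝ, E) M) = fderiv ℝ (fun z : E × E => (f z.1, fderiv ℝ f z.1 z.2))
        (x, (y : E)) := by
    have hr : range 𝓘(ℝ, E).tangent = univ := by
      simp [ModelWithCorners.tangent]
    refine (if_pos hmd).trans ?_
    rw [hext, hr]
    exact (congrFun (fderivWithin_univ (𝕜 := ℝ)) _).trans (hev.fderiv_eq (𝕜 := ℝ))
  have h6 := congrArg (fun L : E × E →L[ℝ] E × E => L (u, w)) (hder.trans hG.fderiv)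
  refine Eq.trans h6 ?_
  rw [hself, hself]
  exact Prod.ext rfl (add_comm _ _)

theorem tangentCoord_canonicalFlip {p₀ : M} {W : SecondTangentBundle E M}
    (hp : W.proj.proj ∈ (chartAt E p₀).source) :
    tangentCoord p₀ (canonicalFlip W).proj =
      (extChartAt 𝓘(ℝ, E) p₀ W.proj.proj, (secondCoord p₀ W).1) := by
  obtain ⟨⟨p, y⟩, u, w⟩ := W
  exact Prod.ext rfl (congrArg Prod.fst (secondCoord_mk hp y u w)).symm

/-- The involution is defined in the preferred chart at the base point. It has the same form in
every chart because the extra term of the coordinate change is a second derivative, symmetric in `u`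
and `y`. -/
theorem secondCoord_canonicalFlip {p₀ : M} {W : SecondTangentBundle E M}
    (hp : W.proj.proj ∈ (chartAt E p₀).source) :
    secondCoord p₀ (canonicalFlip W) = ((tangentCoord p₀ W.proj).2, (secondCoord p₀ W).2) := by
  obtain ⟨⟨p, y⟩, u, w⟩ := W
  refine (secondCoord_mk hp u y w).trans (Prod.ext rfl ?_)
  refine Eq.trans ?_ (congrArg Prod.snd (secondCoord_mk hp y u w)).symm
  have hsymm : IsSymmSndFDerivAt ℝ (extChartAt 𝓘(ℝ, E) p₀ ∘ (extChartAt 𝓘(ℝ, E) p).symm)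
      (extChartAt 𝓘(ℝ, E) p p) :=
    (contDiffAt_coordChange hp).isSymmSndFDerivAt (by simp; norm_cast)
  exact congrArg (· + (fibreCoord p₀ p w : E)) (hsymm.eq _ _)

theorem canonicalFlip_canonicalFlip (W : SecondTangentBundle E M) :
    canonicalFlip (canonicalFlip W) = W := rfl

theorem mem_canonicalFlip_image {S : Set (SecondTangentBundle E M)} {W : SecondTangentBundle E M} :
    W ∈ canonicalFlip '' S ↔ canonicalFlip W ∈ S :=
  ⟨fun ⟨V, hV, h⟩ => by rw [← h]; exact hV, fun h => ⟨_, h, canonicalFlip_canonicalFlip W⟩⟩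

end

/-! ### Curves in `TM` and the tangent space of a subbundle -/

section

variable {E : Type*} [NormedAddCommGroup E] [NormedSpace ℝ E]
  {M : Type*} [TopologicalSpace M] [ChartedSpace E M] [IsManifold 𝓘(ℝ, E) ∞ M]

theorem secondTangentBundle_ext {p₀ : M} {W W' : SecondTangentBundle E M}
    (hp : W.proj.proj ∈ (chartAt E p₀).source) (h : W.proj = W'.proj)
    (h' : secondCoord p₀ W = secondCoord p₀ W') : W = W' := by
  obtain ⟨v, w⟩ := W
  obtain ⟨v', w'⟩ := W'
  obtain rfl : v = v' := h
  rw [secondTangent_ext hp h']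

theorem hasDerivWithinAt_tangentCoord {p₀ : M} {γ : ℝ → TangentBundle 𝓘(ℝ, E) M} {J : Set ℝ}
    {t : ℝ} (hγ : MDifferentiableWithinAt 𝓘(ℝ, ℝ) 𝓘(ℝ, E).tangent γ J t)
    (hp : (γ t).1 ∈ (chartAt E p₀).source) :
    HasDerivWithinAt (fun s => tangentCoord p₀ (γ s))
      (secondCoord p₀ (tangentMapWithin 𝓘(ℝ, ℝ) 𝓘(ℝ, E).tangent γ J ⟨t, (1 : ℝ)⟩)) J t := by
  have h1 := ((contMDiffAt_tangentCoord hp).mdifferentiableAt (by simp)).hasMFDerivAt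
  have h2 := (h1.comp_hasMFDerivWithinAt t hγ.hasMFDerivWithinAt).hasFDerivWithinAt
  let L : ℝ →L[ℝ] E × E :=
    (mfderiv 𝓘(ℝ, E).tangent 𝓘(ℝ, E × E) (tangentCoord p₀) (γ t)).comp
      (mfderivWithin 𝓘(ℝ, ℝ) 𝓘(ℝ, E).tangent γ J t)
  have h3 : HasFDerivWithinAt (fun s => tangentCoord p₀ (γ s)) L J t := h2
  exact h3.hasDerivWithinAt

theorem mdifferentiableWithinAt_of_tangentCoord {p₀ : M} {γ : ℝ → TangentBundle 𝓘(ℝ, E) M}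
    {J : Set ℝ} {t : ℝ} (hc : ContinuousWithinAt (fun s => (γ s).1) J t)
    (hp : (γ t).1 ∈ (chartAt E p₀).source)
    (hd : DifferentiableWithinAt ℝ (fun s => tangentCoord p₀ (γ s)) J t) :
    MDifferentiableWithinAt 𝓘(ℝ, ℝ) 𝓘(ℝ, E).tangent γ J t := by
  have h1 : MDifferentiableAt 𝓘(ℝ, E × E) 𝓘(ℝ, E).tangent (tangentCoordSymm p₀)
      (tangentCoord p₀ (γ t)) :=
    (contMDiffAt_tangentCoordSymm ((extChartAt 𝓘(ℝ, E) p₀).map_source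
      (by simpa using hp))).mdifferentiableAt (by simp)
  refine (h1.comp_mdifferentiableWithinAt (f := fun s => tangentCoord p₀ (γ s)) t
    hd.mdifferentiableWithinAt).congr_of_eventuallyEq
    ?_ (tangentCoordSymm_tangentCoord hp).symm
  filter_upwards [hc.preimage_mem_nhdsWithin ((chartAt E p₀).open_source.mem_nhds hp)] with s hs
  exact (tangentCoordSymm_tangentCoord hs).symm

theorem hasDerivWithinAt_extChartAt_comp {p₀ : M} {β : ℝ → M} {J : Set ℝ} {t : ℝ}
    (hβ : MDifferentiableWithinAt 𝓘(ℝ, ℝ) 𝓘(ℝ, E) β J t)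
    (hp : β t ∈ (chartAt E p₀).source) :
    HasDerivWithinAt (fun s => extChartAt 𝓘(ℝ, E) p₀ (β s))
      (fibreCoord p₀ (β t) (velocity β J t)) J t := by
  have h1 := (mdifferentiableAt_extChartAt (I := 𝓘(ℝ, E)) hp).hasMFDerivAt
  rw [fibreCoord_eq_mfderiv hp]
  have h2 := (h1.comp_hasMFDerivWithinAt t hβ.hasMFDerivWithinAt).hasFDerivWithinAt
  let L : ℝ →L[ℝ] E :=
    (mfderiv 𝓘(ℝ, E) 𝓘(ℝ, E) (extChartAt 𝓘(ℝ, E) p₀) (β t)).comp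
      (mfderivWithin 𝓘(ℝ, ℝ) 𝓘(ℝ, E) β J t)
  have h3 : HasFDerivWithinAt (fun s => extChartAt 𝓘(ℝ, E) p₀ (β s)) L J t := h2
  exact h3.hasDerivWithinAt

/-- In the preferred chart at `p₀`, over `V`, the family of subspaces `S` is given by the kernels
of a smooth family `ρ` of projections. -/
structure IsKernelChart (S : ∀ p : M, Submodule ℝ (TangentSpace 𝓘(ℝ, E) p)) (p₀ : M) (V : Set E)
    (ρ : E → E →L[ℝ] E) : Prop where
  isOpen : IsOpen V
  subset : V ⊆ (extChartAt 𝓘(ℝ, E) p₀).target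
  contDiffOn : ContDiffOn ℝ ∞ ρ V
  idem : ∀ x ∈ V, ∀ y, ρ x (ρ x y) = ρ x y
  mem_iff : ∀ p ∈ (chartAt E p₀).source, extChartAt 𝓘(ℝ, E) p₀ p ∈ V →
    ∀ y, y ∈ S p ↔ ρ (extChartAt 𝓘(ℝ, E) p₀ p) (fibreCoord p₀ p y) = 0

namespace IsKernelChart

variable {S : ∀ p : M, Submodule ℝ (TangentSpace 𝓘(ℝ, E) p)} {p₀ : M} {V : Set E}
    {ρ : E → E →L[ℝ] E}

theorem contDiffAt (h : IsKernelChart S p₀ V ρ) {x : E} (hx : x ∈ V) : ContDiffAt ℝ ∞ ρ x :=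
  h.contDiffOn.contDiffAt (h.isOpen.mem_nhds hx)

theorem hasFDerivAt (h : IsKernelChart S p₀ V ρ) {x : E} (hx : x ∈ V) :
    HasFDerivAt ρ (fderiv ℝ ρ x) x :=
  ((h.contDiffAt hx).differentiableAt (by simp)).hasFDerivAt

/-- The equations of the tangent space of the total space of a subbundle. -/
theorem mem_tangentsTo_iff (h : IsKernelChart S p₀ V ρ) {W : SecondTangentBundle E M}
    (hp : W.proj.proj ∈ (chartAt E p₀).source)
    (hV : extChartAt 𝓘(ℝ, E) p₀ W.proj.proj ∈ V) :
    W ∈ tangentsTo (totalSet S) ↔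
      ρ (extChartAt 𝓘(ℝ, E) p₀ W.proj.proj) (tangentCoord p₀ W.proj).2 = 0 ∧
      ρ (extChartAt 𝓘(ℝ, E) p₀ W.proj.proj) (secondCoord p₀ W).2 +
        fderiv ℝ ρ (extChartAt 𝓘(ℝ, E) p₀ W.proj.proj) (secondCoord p₀ W).1
          (tangentCoord p₀ W.proj).2 = 0 := by
  constructor
  · rintro ⟨γ, hγ, hS, rfl⟩
    change (γ 0).1 ∈ _ at hp
    change extChartAt 𝓘(ℝ, E) p₀ (γ 0).1 ∈ V at hV
    have hmem : γ 0 ∈ totalSet S := hS.self_of_nhds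
    refine ⟨(h.mem_iff _ hp hV _).1 hmem, ?_⟩
    have hd := hasDerivWithinAt_tangentCoord (J := univ) (t := 0) (p₀ := p₀)
      (mdifferentiableWithinAt_univ.2 (hγ.mdifferentiableAt (by simp))) hp
    rw [tangentMapWithin_univ, hasDerivWithinAt_univ] at hd
    set D := secondCoord p₀ (tangentMap 𝓘(ℝ, ℝ) 𝓘(ℝ, E).tangent γ ⟨0, (1 : ℝ)⟩) with hD
    have h1 : HasDerivAt (fun s => (tangentCoord p₀ (γ s)).1) D.1 0 :=
      hasFDerivAt_fst.comp_hasDerivAt (f := fun s => tangentCoord p₀ (γ s)) (0 : ℝ) hd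
    have h2 : HasDerivAt (fun s => (tangentCoord p₀ (γ s)).2) D.2 0 :=
      hasFDerivAt_snd.comp_hasDerivAt (f := fun s => tangentCoord p₀ (γ s)) (0 : ℝ) hd
    have h3 : HasDerivAt (fun s => ρ (tangentCoord p₀ (γ s)).1)
        (fderiv ℝ ρ (extChartAt 𝓘(ℝ, E) p₀ (γ 0).1) D.1) 0 :=
      (h.hasFDerivAt hV).comp_hasDerivAt (0 : ℝ) h1
    have h4 := h3.clm_apply h2
    have hcont : ContinuousAt (fun s => (γ s).1) 0 :=
      (Bundle.contMDiff_proj (TangentSpace 𝓘(ℝ, E))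
        (IB := 𝓘(ℝ, E)) (n := ∞)).continuous.continuousAt.comp hγ.continuousAt
    -- Along a curve in the total space `ρ(x) y` vanishes near `0`; its derivative gives the second
    -- equation.
    have hz : (fun s => ρ (tangentCoord p₀ (γ s)).1 (tangentCoord p₀ (γ s)).2) =ᶠ[𝓝 0]
        fun _ => 0 := by
      filter_upwards [hS, hcont ((chartAt E p₀).open_source.mem_nhds hp),
        h1.continuousAt (h.isOpen.mem_nhds hV)] with s hs hs1 hs2
      exact (h.mem_iff _ hs1 hs2 _).1 hs
    have h5 := h4.unique ((hasDerivAt_const (0 : ℝ) (0 : E)).congr_of_eventuallyEq hz)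
    rw [add_comm] at h5
    exact h5
  · rintro ⟨h1, h2⟩
    set x := extChartAt 𝓘(ℝ, E) p₀ W.proj.proj with hx
    set y := (tangentCoord p₀ W.proj).2 with hy
    set u := (secondCoord p₀ W).1 with hu
    set w := (secondCoord p₀ W).2 with hw
    set ξ : ℝ → E := fun s => x + s • u with hξ
    -- The straight line with velocity `(u, w)` leaves the subbundle; applying `1 - ρ` to the fibre
    -- component brings it back. The two equations say that this changes neither the initial point
    -- nor the initial velocity.
    set c : ℝ → E × E := fun s => (ξ s, (y + s • w) - ρ (ξ s) (y + s • w)) with hc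
    have hξ0 : ξ 0 = x := by simp [hξ]
    have hξc : ContDiff ℝ ∞ ξ := by fun_prop
    have hρξ : ContDiffAt ℝ ∞ (fun s => ρ (ξ s)) 0 :=
      ContDiffAt.comp (0 : ℝ) (hξ0 ▸ h.contDiffAt hV) hξc.contDiffAt
    have hyc : ContDiffAt ℝ ∞ (fun s : ℝ => y + s • w) 0 := by fun_prop
    have hcc : ContDiffAt ℝ ∞ c 0 := hξc.contDiffAt.prodMk (hyc.sub (hρξ.clm_apply hyc))
    have hc0 : c 0 = tangentCoord p₀ W.proj := by
      refine Prod.ext hξ0 ?_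
      simp only [hc, hξ0, zero_smul, add_zero]
      rw [h1, sub_zero]
    have hcV : ∀ᶠ s in 𝓝 (0 : ℝ), ξ s ∈ V :=
      hξc.continuous.continuousAt (by rw [hξ0]; exact h.isOpen.mem_nhds hV)
    have hγ0 : tangentCoordSymm p₀ (c 0) = W.proj := by
      rw [hc0, tangentCoordSymm_tangentCoord hp]
    have hsm : ContMDiffAt 𝓘(ℝ, ℝ) 𝓘(ℝ, E).tangent ∞ (fun s => tangentCoordSymm p₀ (c s)) 0 :=
      (contMDiffAt_tangentCoordSymm (h.subset (by simpa [hc, hξ0] using hV))).comp (0 : ℝ)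
        hcc.contMDiffAt
    refine ⟨fun s => tangentCoordSymm p₀ (c s), hsm, ?_, ?_⟩
    · filter_upwards [hcV] with s hs
      have ht := h.subset hs
      have hs' : (extChartAt 𝓘(ℝ, E) p₀).symm (ξ s) ∈ (chartAt E p₀).source := by
        simpa using (extChartAt 𝓘(ℝ, E) p₀).map_target ht
      have hr : extChartAt 𝓘(ℝ, E) p₀ ((extChartAt 𝓘(ℝ, E) p₀).symm (ξ s)) = ξ s :=
        (extChartAt 𝓘(ℝ, E) p₀).right_inv ht
      refine (h.mem_iff _ hs' (by rw [hr]; exact hs) _).2 ?_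
      refine (congrArg (ρ _) (fibreCoord_fibreCoordSymm hs' _)).trans ?_
      rw [hr, map_sub, h.idem _ hs, sub_self]
    · refine secondTangentBundle_ext hp hγ0.symm ?_
      have hd := hasDerivWithinAt_tangentCoord (J := univ) (t := 0) (p₀ := p₀)
        (mdifferentiableWithinAt_univ.2 (hsm.mdifferentiableAt (by simp))) (by rw [hγ0]; exact hp)
      rw [tangentMapWithin_univ, hasDerivWithinAt_univ] at hd
      have hcoord : (fun s => tangentCoord p₀ (tangentCoordSymm p₀ (c s))) =ᶠ[𝓝 0] c := by
        filter_upwards [hcV] with s hs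
        exact tangentCoord_tangentCoordSymm (h.subset hs)
      have hd' := hd.congr_of_eventuallyEq hcoord.symm
      have k1 : HasDerivAt ξ u 0 := by
        simpa [hξ] using ((hasDerivAt_id (0 : ℝ)).smul_const u).const_add x
      have k2 : HasDerivAt (fun s : ℝ => y + s • w) w 0 := by
        simpa using ((hasDerivAt_id (0 : ℝ)).smul_const w).const_add y
      have k3 : HasDerivAt (fun s => ρ (ξ s)) (fderiv ℝ ρ x u) 0 :=
        HasFDerivAt.comp_hasDerivAt (0 : ℝ) (hξ0.symm ▸ h.hasFDerivAt hV) k1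
      have k4 := k1.prodMk (k2.sub (k3.clm_apply k2))
      rw [hd'.unique k4]
      refine Prod.ext rfl ?_
      simp only [hξ0, zero_smul, add_zero]
      rw [add_comm, h2, sub_zero]

end IsKernelChart

end

/-! ### The projection onto `K` along `H` in a chart -/

section

variable {E : Type*} [NormedAddCommGroup E] [NormedSpace ℝ E]
  {M : Type*} [TopologicalSpace M] [ChartedSpace E M] [IsManifold 𝓘(ℝ, E) ∞ M]

/-- A vector field, read in the preferred chart at `p₀`. -/
def fieldCoord (p₀ : M) (X : ∀ p : M, TangentSpace 𝓘(ℝ, E) p) (x : E) : E :=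
  fibreCoord p₀ ((extChartAt 𝓘(ℝ, E) p₀).symm x) (X ((extChartAt 𝓘(ℝ, E) p₀).symm x))

theorem fieldCoord_extChartAt {p₀ p : M} (X : ∀ p : M, TangentSpace 𝓘(ℝ, E) p)
    (hp : p ∈ (chartAt E p₀).source) :
    fieldCoord p₀ X (extChartAt 𝓘(ℝ, E) p₀ p) = fibreCoord p₀ p (X p) := by
  rw [fieldCoord, (extChartAt 𝓘(ℝ, E) p₀).left_inv (by simpa using hp)]

theorem contDiffAt_fieldCoord {p₀ : M} {X : ∀ p : M, TangentSpace 𝓘(ℝ, E) p} {x : E}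
    (hx : x ∈ (extChartAt 𝓘(ℝ, E) p₀).target)
    (hX : ContMDiffAt 𝓘(ℝ, E) 𝓘(ℝ, E).tangent ∞
      (fun p => (⟨p, X p⟩ : TangentBundle 𝓘(ℝ, E) M)) ((extChartAt 𝓘(ℝ, E) p₀).symm x)) :
    ContDiffAt ℝ ∞ (fieldCoord p₀ X) x := by
  have h1 : ContMDiffAt 𝓘(ℝ, E) 𝓘(ℝ, E) ∞ (extChartAt 𝓘(ℝ, E) p₀).symm x :=
    (contMDiffOn_extChartAt_symm p₀).contMDiffAt ((isOpen_extChartAt_target p₀).mem_nhds hx)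
  have hs : (extChartAt 𝓘(ℝ, E) p₀).symm x ∈ (chartAt E p₀).source := by
    simpa using (extChartAt 𝓘(ℝ, E) p₀).map_target hx
  have h2 := ((contMDiffAt_tangentCoord (p₀ := p₀)
    (v := ⟨_, X ((extChartAt 𝓘(ℝ, E) p₀).symm x)⟩) hs).comp
      ((extChartAt 𝓘(ℝ, E) p₀).symm x) hX).comp x h1
  exact (contDiff_snd.contDiffAt).comp x h2.contDiffAt

/-- In the preferred chart at `p₀`, over `V`, the projection onto `K` along `H` is given by the
smooth family `π`. -/
structure IsProjectionChart (H K : ∀ p : M, Submodule ℝ (TangentSpace 𝓘(ℝ, E) p)) (p₀ : M)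
    (V : Set E) (π : E → E →L[ℝ] E) : Prop where
  left : IsKernelChart H p₀ V π
  right : IsKernelChart K p₀ V fun x => ContinuousLinearMap.id ℝ E - π x

/-- The linear combinations of two families of vectors, as a continuous linear map. -/
def combination {k l : ℕ} (e : Fin k → E) (f : Fin l → E) :
    ((Fin k → ℝ) × (Fin l → ℝ)) →L[ℝ] E :=
  ∑ i, ((ContinuousLinearMap.proj (R := ℝ) (φ := fun _ : Fin k => ℝ) i).comp
      (ContinuousLinearMap.fst ℝ (Fin k → ℝ) (Fin l → ℝ))).smulRight (e i) +
    ∑ j, ((ContinuousLinearMap.proj (R := ℝ) (φ := fun _ : Fin l => ℝ) j).comp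
      (ContinuousLinearMap.snd ℝ (Fin k → ℝ) (Fin l → ℝ))).smulRight (f j)

theorem combination_apply {k l : ℕ} (e : Fin k → E) (f : Fin l → E) (c : Fin k → ℝ)
    (d : Fin l → ℝ) : combination e f (c, d) = ∑ i, c i • e i + ∑ j, d j • f j := by
  simp [combination]

theorem contDiffOn_combination {k l : ℕ} {e : Fin k → E → E} {f : Fin l → E → E} {V : Set E}
    (he : ∀ i, ContDiffOn ℝ ∞ (e i) V) (hf : ∀ j, ContDiffOn ℝ ∞ (f j) V) :
    ContDiffOn ℝ ∞ (fun x => combination (fun i => e i x) fun j => f j x) V := by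
  refine ContDiffOn.add ?_ ?_
  · exact ContDiffOn.sum fun i _ => contDiffOn_const.smulRight (he i)
  · exact ContDiffOn.sum fun j _ => contDiffOn_const.smulRight (hf j)

/-- Local frames of `H` and `K` together form a frame of `TM`. The projection is the constant
coordinate projection conjugated by the frame matrix, and is smooth because inversion of linear maps
is. -/
theorem exists_isProjectionChart [FiniteDimensional ℝ E]
    {H K : ∀ p : M, Submodule ℝ (TangentSpace 𝓘(ℝ, E) p)}
    (hH : IsSmoothSubbundle H) (hK : IsSmoothSubbundle K) (hHK : ∀ p, IsCompl (H p) (K p))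
    (p₀ : M) :
    ∃ (V : Set E) (π : E → E →L[ℝ] E), extChartAt 𝓘(ℝ, E) p₀ p₀ ∈ V ∧
      IsProjectionChart H K p₀ V π := by
  obtain ⟨k, e, U₁, hU₁, he, heH⟩ := hH p₀
  obtain ⟨l, f, U₂, hU₂, hf, hfK⟩ := hK p₀
  obtain ⟨U, hUsub, hUo, hpU⟩ := mem_nhds_iff.1 (inter_mem hU₁ hU₂)
  set φ := extChartAt 𝓘(ℝ, E) p₀ with hφ
  set V : Set E := φ.target ∩ φ.symm ⁻¹' U with hV
  have hVo : IsOpen V := (continuousOn_extChartAt_symm p₀).isOpen_inter_preimage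
    (isOpen_extChartAt_target p₀) hUo
  have hsrc : ∀ x ∈ V, φ.symm x ∈ (chartAt E p₀).source := fun x hx => by
    simpa [hφ] using φ.map_target hx.1
  have hec : ∀ i, ContDiffOn ℝ ∞ (fieldCoord p₀ (e i)) V := fun i x hx =>
    (contDiffAt_fieldCoord hx.1 ((he i).contMDiffAt
      (mem_of_superset (hUo.mem_nhds hx.2) fun y hy => (hUsub hy).1))).contDiffWithinAt
  have hfc : ∀ i, ContDiffOn ℝ ∞ (fieldCoord p₀ (f i)) V := fun i x hx =>
    (contDiffAt_fieldCoord hx.1 ((hf i).contMDiffAt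
      (mem_of_superset (hUo.mem_nhds hx.2) fun y hy => (hUsub hy).2))).contDiffWithinAt
  set L : E → ((Fin k → ℝ) × (Fin l → ℝ)) →L[ℝ] E := fun x =>
    combination (fun i => fieldCoord p₀ (e i) x) fun j => fieldCoord p₀ (f j) x with hL
  have hLc : ContDiffOn ℝ ∞ L V := contDiffOn_combination hec hfc
  have hLap : ∀ x c d, L x (c, d) = fibreCoord p₀ (φ.symm x)
      (∑ i, c i • e i (φ.symm x) + ∑ j, d j • f j (φ.symm x)) := by
    intro x c d
    rw [hL, combination_apply, map_add, map_sum, map_sum]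
    simp only [map_smul]
    rfl
  have hmH : ∀ x ∈ V, ∀ y, y ∈ H (φ.symm x) ↔ ∃ c : Fin k → ℝ, ∑ i, c i • e i (φ.symm x) = y := by
    intro x hx y
    rw [← (heH _ (hUsub hx.2).1).2, Submodule.mem_span_range_iff_exists_fun]
  have hmK : ∀ x ∈ V, ∀ y, y ∈ K (φ.symm x) ↔ ∃ c : Fin l → ℝ, ∑ i, c i • f i (φ.symm x) = y := by
    intro x hx y
    rw [← (hfK _ (hUsub hx.2).2).2, Submodule.mem_span_range_iff_exists_fun]
  have hinj : ∀ x ∈ V, Function.Injective (L x) := by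
    intro x hx
    rw [injective_iff_map_eq_zero]
    rintro ⟨c, d⟩ h
    rw [hLap] at h
    have h0 := fibreCoord_injective (hsrc x hx) (h.trans (map_zero _).symm)
    have h1 : ∑ i, c i • e i (φ.symm x) ∈ H (φ.symm x) := (hmH x hx _).2 ⟨c, rfl⟩
    have h2 : ∑ i, d i • f i (φ.symm x) ∈ K (φ.symm x) := (hmK x hx _).2 ⟨d, rfl⟩
    have h3 : ∑ i, c i • e i (φ.symm x) ∈ K (φ.symm x) := by
      rw [eq_neg_of_add_eq_zero_left h0]
      exact neg_mem h2
    have h4 : ∑ i, c i • e i (φ.symm x) = 0 := by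
      have := (hHK (φ.symm x)).disjoint.le_bot ⟨h1, h3⟩
      simpa using this
    rw [h4, zero_add] at h0
    have h5 := Fintype.linearIndependent_iff.1 (heH _ (hUsub hx.2).1).1 c h4
    have h6 := Fintype.linearIndependent_iff.1 (hfK _ (hUsub hx.2).2).1 d h0
    exact Prod.ext (funext h5) (funext h6)
  have hrep : ∀ x ∈ V, ∀ y : TangentSpace 𝓘(ℝ, E) (φ.symm x), ∃ (c : Fin k → ℝ) (d : Fin l → ℝ),
      ∑ i, c i • e i (φ.symm x) + ∑ j, d j • f j (φ.symm x) = y := by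
    intro x hx y
    have : y ∈ H (φ.symm x) ⊔ K (φ.symm x) := by rw [(hHK _).sup_eq_top]; trivial
    obtain ⟨u, hu, v, hv, rfl⟩ := Submodule.mem_sup.1 this
    obtain ⟨c, rfl⟩ := (hmH x hx u).1 hu
    obtain ⟨d, rfl⟩ := (hmK x hx v).1 hv
    exact ⟨c, d, rfl⟩
  have hsurj : ∀ x ∈ V, Function.Surjective (L x) := by
    intro x hx y
    obtain ⟨c, d, h⟩ := hrep x hx (fibreCoordSymm p₀ _ y)
    exact ⟨(c, d), by rw [hLap, h, fibreCoord_fibreCoordSymm (hsrc x hx)]⟩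
  let T : ∀ x ∈ V, ((Fin k → ℝ) × (Fin l → ℝ)) ≃L[ℝ] E := fun x hx =>
    (LinearEquiv.ofBijective (L x : _ →ₗ[ℝ] E) ⟨hinj x hx, hsurj x hx⟩).toContinuousLinearEquiv
  have hT : ∀ x (hx : x ∈ V), (T x hx : _ →L[ℝ] E) = L x := fun x hx => by ext z <;> rfl
  set P : ((Fin k → ℝ) × (Fin l → ℝ)) →L[ℝ] ((Fin k → ℝ) × (Fin l → ℝ)) :=
    (ContinuousLinearMap.inr ℝ _ _).comp (ContinuousLinearMap.snd ℝ _ _) with hP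
  -- Take the coefficients of a vector in the joint frame, kill those along `H`, and recombine.
  set π : E → E →L[ℝ] E := fun x => (L x).comp (P.comp (L x).inverse) with hπ
  have hinv : ∀ x ∈ V, ∀ z, (L x).inverse (L x z) = z := by
    intro x hx z
    rw [← hT x hx, ContinuousLinearMap.inverse_equiv]
    exact (T x hx).symm_apply_apply z
  have hπL : ∀ x ∈ V, ∀ c d, π x (L x (c, d)) = L x (0, d) := by
    intro x hx c d
    simp [hπ, hinv x hx, hP]
  have hπc : ContDiffOn ℝ ∞ π V := by
    intro x hx
    have h1 : ContDiffAt ℝ ∞ L x := hLc.contDiffAt (hVo.mem_nhds hx)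
    have h2 : ContDiffAt ℝ ∞ (fun y => (L y).inverse) x :=
      (hT x hx ▸ contDiffAt_map_inverse (T x hx)).comp x h1
    exact (h1.clm_comp (contDiffAt_const.clm_comp h2)).contDiffWithinAt
  have hidem : ∀ x ∈ V, ∀ y, π x (π x y) = π x y := by
    intro x hx y
    obtain ⟨⟨c, d⟩, rfl⟩ := hsurj x hx y
    rw [hπL x hx, hπL x hx]
  refine ⟨V, π, ⟨mem_extChartAt_target p₀, ?_⟩, ⟨hVo, inter_subset_left, hπc, hidem, ?_⟩,
    ⟨hVo, inter_subset_left, contDiffOn_const.sub hπc, ?_, ?_⟩⟩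
  · change φ.symm (φ p₀) ∈ U
    rw [hφ, extChartAt_to_inv]
    exact hpU
  · intro p hp hpV y
    obtain ⟨x, hx, rfl⟩ : ∃ x ∈ V, φ.symm x = p :=
      ⟨φ p, hpV, φ.left_inv (by simpa [hφ] using hp)⟩
    rw [← hφ, φ.right_inv hx.1]
    obtain ⟨c, d, rfl⟩ := hrep x hx y
    rw [← hLap, hπL x hx, hmH x hx]
    constructor
    · rintro ⟨c', h⟩
      have h1 : L x (c', 0) = L x (c, d) := by
        rw [hLap, hLap, ← h]; simp
      obtain ⟨-, rfl⟩ := Prod.mk.inj (hinj x hx h1)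
      exact map_zero (L x)
    · intro h
      have h2 : ((0 : Fin k → ℝ), d) = 0 := hinj x hx (h.trans (map_zero _).symm)
      have hd : d = 0 := (Prod.ext_iff.1 h2).2
      exact ⟨c, by simp [hd]⟩
  · intro x hx y
    simp [hidem x hx]
  · intro p hp hpV y
    obtain ⟨x, hx, rfl⟩ : ∃ x ∈ V, φ.symm x = p :=
      ⟨φ p, hpV, φ.left_inv (by simpa [hφ] using hp)⟩
    rw [← hφ, φ.right_inv hx.1]
    obtain ⟨c, d, rfl⟩ := hrep x hx y
    have h0 : (ContinuousLinearMap.id ℝ E - π x) (L x (c, d)) = L x (c, 0) := by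
      have : (c, d) = (c, 0) + ((0 : Fin k → ℝ), d) := by simp
      change L x (c, d) - π x (L x (c, d)) = _
      rw [hπL x hx, this, map_add, add_sub_cancel_right]
    rw [← hLap, h0, hmK x hx]
    constructor
    · rintro ⟨d', h⟩
      have h1 : L x (0, d') = L x (c, d) := by
        rw [hLap, hLap, ← h]; simp
      obtain ⟨rfl, -⟩ := Prod.mk.inj (hinj x hx h1)
      exact map_zero (L x)
    · intro h
      have h2 : (c, (0 : Fin l → ℝ)) = 0 := hinj x hx (h.trans (map_zero _).symm)
      have hd : c = 0 := (Prod.ext_iff.1 h2).1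
      exact ⟨d, by simp [hd]⟩

end

/-! ### Parallel sections as solutions of a linear differential equation -/

section

variable {E : Type*} [NormedAddCommGroup E] [NormedSpace ℝ E]
  {M : Type*} [TopologicalSpace M] [ChartedSpace E M] [IsManifold 𝓘(ℝ, E) ∞ M]
  {H K : ∀ p : M, Submodule ℝ (TangentSpace 𝓘(ℝ, E) p)}

namespace IsProjectionChart

variable {p₀ : M} {V : Set E} {π : E → E →L[ℝ] E}

/-- Derivative of `π² = π`. It shows that `Dπ(v)` maps `ker π` into the image of `π`. -/
theorem fderiv_idem (h : IsProjectionChart H K p₀ V π) {x : E} (hx : x ∈ V) (v y : E) :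
    fderiv ℝ π x v (π x y) + π x (fderiv ℝ π x v y) = fderiv ℝ π x v y := by
  have h1 := h.left.hasFDerivAt hx
  have h2 : HasFDerivAt (fun z => π z y) ((fderiv ℝ π x).flip y) x :=
    (h1.clm_apply (hasFDerivAt_const y x)).congr_fderiv (by ext; simp)
  have h3 := h1.clm_apply h2
  have h4 : (fun z => π z (π z y)) =ᶠ[𝓝 x] fun z => π z y := by
    filter_upwards [h.left.isOpen.mem_nhds hx] with z hz using h.left.idem z hz y
  have h5 := congrArg (fun L : E →L[ℝ] E => L v) (h3.unique (h2.congr_of_eventuallyEq h4))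
  simpa [add_comm] using h5

/-- The companion fact: `Dπ(v)` maps the image of `π` into its kernel. -/
theorem apply_fderiv_apply (h : IsProjectionChart H K p₀ V π) {x : E} (hx : x ∈ V) (v y : E) :
    π x (fderiv ℝ π x v (π x y)) = 0 := by
  have := h.fderiv_idem hx v (π x y)
  rw [h.left.idem x hx] at this
  simpa using this

theorem fderiv_complement (h : IsProjectionChart H K p₀ V π) {x : E} (hx : x ∈ V) :
    fderiv ℝ (fun z => ContinuousLinearMap.id ℝ E - π z) x = -fderiv ℝ π x :=
  ((h.left.hasFDerivAt hx).const_sub _).fderiv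

theorem mem_right_iff (h : IsProjectionChart H K p₀ V π) {p : M} (hp : p ∈ (chartAt E p₀).source)
    (hV : extChartAt 𝓘(ℝ, E) p₀ p ∈ V) (y : TangentSpace 𝓘(ℝ, E) p) :
    y ∈ K p ↔ π (extChartAt 𝓘(ℝ, E) p₀ p) (fibreCoord p₀ p y) = fibreCoord p₀ p y := by
  rw [h.right.mem_iff p hp hV]
  exact sub_eq_zero.trans eq_comm

theorem apply_fibreCoord (h : IsProjectionChart H K p₀ V π) (hHK : ∀ p, IsCompl (H p) (K p))
    {p : M} (hp : p ∈ (chartAt E p₀).source)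
    (hV : extChartAt 𝓘(ℝ, E) p₀ p ∈ V) (y : TangentSpace 𝓘(ℝ, E) p) :
    π (extChartAt 𝓘(ℝ, E) p₀ p) (fibreCoord p₀ p y) =
      fibreCoord p₀ p ((K p).projectionOnto (H p) (hHK p).symm y : TangentSpace 𝓘(ℝ, E) p) := by
  have hy : y = (H p).projectionOnto (K p) (hHK p) y + (K p).projectionOnto (H p) (hHK p).symm y :=
    (Submodule.projection_add_projection_eq_self (hHK p) y).symm
  have h1 := (h.left.mem_iff p hp hV _).1 ((H p).projectionOnto (K p) (hHK p) y).2
  have h2 := (h.mem_right_iff hp hV _).1 ((K p).projectionOnto (H p) (hHK p).symm y).2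
  conv_lhs => rw [hy]
  rw [map_add, map_add, h1, h2, zero_add]

end IsProjectionChart

/-- The coefficients, at a point `x` of a chart, of the connection on `β^* K`: a section `y` is
parallel if `y' = connectionCoeff π x β' y`. -/
def connectionCoeff (π : E → E →L[ℝ] E) (x v : E) : E →L[ℝ] E :=
  fderiv ℝ π x v - (fderiv ℝ π x).flip v

theorem connectionCoeff_apply (π : E → E →L[ℝ] E) (x v y : E) :
    connectionCoeff π x v y = fderiv ℝ π x v y - fderiv ℝ π x y v := rfl

/-- The section `σ` of `β^* K` is parallel at time `t`. -/
def IsParallelAt (H K : ∀ p : M, Submodule ℝ (TangentSpace 𝓘(ℝ, E) p)) (β : ℝ → M) (J : Set ℝ)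
    (σ : ∀ t : ℝ, K (β t)) (t : ℝ) : Prop :=
  MDifferentiableWithinAt 𝓘(ℝ, ℝ) (𝓘(ℝ, E).tangent)
      (fun t => (⟨β t, (σ t : TangentSpace 𝓘(ℝ, E) (β t))⟩ : TangentBundle 𝓘(ℝ, E) M)) J t ∧
    tangentMapWithin 𝓘(ℝ, ℝ) (𝓘(ℝ, E).tangent)
      (fun t => (⟨β t, (σ t : TangentSpace 𝓘(ℝ, E) (β t))⟩ : TangentBundle 𝓘(ℝ, E) M)) J
      ⟨t, (1 : ℝ)⟩ ∈ tangentsTo (totalSet K) ∩ canonicalFlip '' tangentsTo (totalSet H)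

theorem isParallel_iff {β : ℝ → M} {J : Set ℝ} {σ : ∀ t : ℝ, K (β t)} :
    IsParallel H K β J σ ↔ ∀ t ∈ J, IsParallelAt H K β J σ t :=
  ⟨fun h t ht => ⟨h.1 t ht, h.2 t ht⟩, fun h => ⟨fun t ht => (h t ht).1, fun t ht => (h t ht).2⟩⟩

/-- In a chart, parallel sections are the solutions of a linear differential equation. -/
theorem IsProjectionChart.isParallelAt_iff {p₀ : M} {V : Set E} {π : E → E →L[ℝ] E}
    (h : IsProjectionChart H K p₀ V π) {β : ℝ → M} {J : Set ℝ} {σ : ∀ t : ℝ, K (β t)} {t : ℝ}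
    (hJ : UniqueDiffWithinAt ℝ J t) (hβ : MDifferentiableWithinAt 𝓘(ℝ, ℝ) 𝓘(ℝ, E) β J t)
    (hβH : velocity β J t ∈ H (β t)) (hp : β t ∈ (chartAt E p₀).source)
    (hV : extChartAt 𝓘(ℝ, E) p₀ (β t) ∈ V) :
    IsParallelAt H K β J σ t ↔
      HasDerivWithinAt (fun s => fibreCoord p₀ (β s) (σ s))
        (connectionCoeff π (extChartAt 𝓘(ℝ, E) p₀ (β t)) (fibreCoord p₀ (β t) (velocity β J t))
          (fibreCoord p₀ (β t) (σ t))) J t := by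
  set γ : ℝ → TangentBundle 𝓘(ℝ, E) M := fun t => ⟨β t, (σ t : TangentSpace 𝓘(ℝ, E) (β t))⟩
  set x : E := extChartAt 𝓘(ℝ, E) p₀ (β t) with hx
  set v : E := fibreCoord p₀ (β t) (velocity β J t) with hv
  set y : E := fibreCoord p₀ (β t) (σ t) with hy
  have hxd : HasDerivWithinAt (fun s => extChartAt 𝓘(ℝ, E) p₀ (β s)) v J t :=
    hasDerivWithinAt_extChartAt_comp hβ hp
  have hvH : π x v = 0 := (h.left.mem_iff _ hp hV _).1 hβH
  have hyK : π x y = y := (h.mem_right_iff hp hV _).1 (σ t).2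
  set W := tangentMapWithin 𝓘(ℝ, ℝ) 𝓘(ℝ, E).tangent γ J ⟨t, (1 : ℝ)⟩ with hW
  -- Tangency to `K` reads `(1 - π) w = Dπ(v) y`. Tangency of the flipped vector, with `v` and `y`
  -- exchanged, to `H` reads `π w = -Dπ(y) v`. These are the components of `w` along `H` and `K`, so
  -- together they amount to a single formula for `w`.
  have key : ∀ w : E, secondCoord p₀ W = (v, w) →
      (W ∈ tangentsTo (totalSet K) ∩ canonicalFlip '' tangentsTo (totalSet H) ↔
        w = connectionCoeff π x v y) := by
    intro w hw
    have hW1 : W.proj.proj ∈ (chartAt E p₀).source := hp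
    have hW2 : extChartAt 𝓘(ℝ, E) p₀ W.proj.proj ∈ V := hV
    have hxW : extChartAt 𝓘(ℝ, E) p₀ W.proj.proj = x := rfl
    have hxF : extChartAt 𝓘(ℝ, E) p₀ (canonicalFlip W).proj.proj = x := rfl
    have hyW : (tangentCoord p₀ W.proj).2 = y := rfl
    rw [mem_inter_iff, mem_canonicalFlip_image, h.right.mem_tangentsTo_iff hW1 hW2,
      h.left.mem_tangentsTo_iff (W := canonicalFlip W) hW1 hW2, tangentCoord_canonicalFlip hW1,
      secondCoord_canonicalFlip hW1, hw, hxW, hxF, hyW, h.fderiv_complement hV,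
      connectionCoeff_apply]
    simp only [neg_apply, sub_apply,
      ContinuousLinearMap.id_apply, hvH, hyK, sub_self, true_and]
    constructor
    · rintro ⟨h1, h2⟩
      rw [← sub_eq_add_neg, sub_sub, sub_eq_zero] at h1
      rw [h1, eq_neg_of_add_eq_zero_left h2]
      abel
    · rintro rfl
      -- For the converse, `Dπ(v) y` lies in `H` since `y ∈ K`, and `Dπ(y) v` lies in `K` since `v ∈
      -- H`.
      have h3 : π x (fderiv ℝ π x v y) = 0 := by
        have := h.apply_fderiv_apply hV v y
        rwa [hyK] at this
      have h4 : π x (fderiv ℝ π x y v) = fderiv ℝ π x y v := by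
        have := h.fderiv_idem hV y v
        rwa [hvH, map_zero, zero_add] at this
      rw [map_sub, h3, h4]
      constructor <;> abel
  constructor
  · rintro ⟨h1, h2⟩
    have hd := hasDerivWithinAt_tangentCoord (p₀ := p₀) h1 hp
    have hd1 : HasDerivWithinAt (fun s => extChartAt 𝓘(ℝ, E) p₀ (β s)) (secondCoord p₀ W).1 J t :=
      hasFDerivAt_fst.comp_hasDerivWithinAt (f := fun s => tangentCoord p₀ (γ s)) t hd
    have hd2 : HasDerivWithinAt (fun s => fibreCoord p₀ (β s) (σ s)) (secondCoord p₀ W).2 J t :=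
      hasFDerivAt_snd.comp_hasDerivWithinAt (f := fun s => tangentCoord p₀ (γ s)) t hd
    have hv' : (secondCoord p₀ W).1 = v := hJ.eq_deriv _ hd1 hxd
    exact hd2.congr_deriv ((key _ (Prod.ext hv' rfl)).1 h2)
  · intro hd
    have hd' := hxd.prodMk hd
    have h1 : MDifferentiableWithinAt 𝓘(ℝ, ℝ) 𝓘(ℝ, E).tangent γ J t :=
      mdifferentiableWithinAt_of_tangentCoord hβ.continuousWithinAt hp
        hd'.differentiableWithinAt
    exact ⟨h1, (key _ (hJ.eq_deriv _ (hasDerivWithinAt_tangentCoord h1 hp) hd')).2 rfl⟩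

end

/-! ### Linear differential equations on a compact interval -/

section

section LinearODE

variable {F : Type*} [NormedAddCommGroup F] [NormedSpace ℝ F]

/-- Local existence of solutions of linear differential equations on a compact interval, including
at its end points. -/
theorem exists_solution_linear [CompleteSpace F] {a b t₁ r : ℝ} (hr : 0 < r) (ht₁ : t₁ ∈ Icc a b)
    {T : ℝ → F →L[ℝ] F} (hT : ContinuousOn T (Icc a b ∩ Metric.closedBall t₁ r)) (x₀ : F) :
    ∃ δ > 0, δ ≤ r ∧ ∃ α : ℝ → F, α t₁ = x₀ ∧ ∀ t ∈ Icc a b ∩ Metric.ball t₁ δ,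
      HasDerivWithinAt α (T t (α t)) (Icc a b) t := by
  set c := max a (t₁ - r) with hc
  set d := min b (t₁ + r) with hd
  have hcd : Icc a b ∩ Metric.closedBall t₁ r = Icc c d := by
    rw [Real.closedBall_eq_Icc, Icc_inter_Icc]
  rw [hcd] at hT
  have ht₁' : t₁ ∈ Icc c d := by
    rw [← hcd]; exact ⟨ht₁, Metric.mem_closedBall_self hr.le⟩
  have hle : c ≤ d := ht₁'.1.trans ht₁'.2
  -- The coefficient is extended by its boundary values, so that Picard–Lindelöf applies on an
  -- interval centred at `t₁` even if `t₁` is an end point.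
  set S : ℝ → F →L[ℝ] F := IccExtend hle ((Icc c d).domRestrict T) with hS
  have hSc : Continuous S := (continuousOn_iff_continuous_domRestrict.1 hT).Icc_extend'
  have hST : ∀ t ∈ Icc c d, S t = T t := fun t ht => IccExtend_of_mem hle _ ht
  obtain ⟨C, hC⟩ : ∃ C, ∀ t ∈ Icc (t₁ - r) (t₁ + r), ‖S t‖ ≤ C :=
    isCompact_Icc.exists_bound_of_continuousOn hSc.continuousOn
  set C' : NNReal := C.toNNReal with hC'
  have hCC' : ∀ t ∈ Icc (t₁ - r) (t₁ + r), ‖S t‖ ≤ C' := fun t ht =>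
    (hC t ht).trans (Real.le_coe_toNNReal C)
  -- Bound for the right-hand side on the ball of radius `1` about `x₀`. The choice of `δ` below
  -- gives `L * δ ≤ 1`, so solutions stay in that ball.
  set L : NNReal := C' * (‖x₀‖₊ + 1) with hL
  set δ : ℝ := min r (1 / (L + 1)) with hδ
  have hδ0 : 0 < δ := lt_min hr (by positivity)
  have hsub : Icc (t₁ - δ) (t₁ + δ) ⊆ Icc (t₁ - r) (t₁ + r) :=
    Icc_subset_Icc (by linarith [min_le_left r (1 / ((L : ℝ) + 1))])
      (by linarith [min_le_left r (1 / ((L : ℝ) + 1))])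
  have hPL : IsPicardLindelof (fun t x => S t x) (tmin := t₁ - δ) (tmax := t₁ + δ)
      ⟨t₁, by constructor <;> linarith⟩ x₀ 1 0 L C' := by
    refine ⟨fun t ht => ?_, fun x _ => ?_, fun t ht x hx => ?_, ?_⟩
    · exact ((S t).lipschitz.weaken (by exact_mod_cast hCC' t (hsub ht))).lipschitzOnWith
    · exact (hSc.clm_apply continuous_const).continuousOn
    · have hx' : ‖x‖ ≤ ‖x₀‖ + 1 := by
        have := norm_le_norm_add_norm_sub' x x₀
        rw [mem_closedBall_iff_norm] at hx
        simpa using this.trans (add_le_add_right hx _)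
      calc ‖S t x‖ ≤ ‖S t‖ * ‖x‖ := (S t).le_opNorm x
        _ ≤ C' * (‖x₀‖ + 1) := by
          gcongr
          exact hCC' t (hsub ht)
        _ = L := by simp [hL]
    · simp only [add_sub_cancel_left, sub_sub_cancel, max_self, NNReal.coe_one, NNReal.coe_zero,
        sub_zero]
      calc (L : ℝ) * δ ≤ L * (1 / (L + 1)) := by gcongr; exact min_le_right _ _
        _ ≤ 1 := by
          rw [mul_one_div, div_le_one (by positivity)]
          linarith
  obtain ⟨α, hα0, hα⟩ := hPL.exists_eq_forall_mem_Icc_hasDerivWithinAt₀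
  refine ⟨δ, hδ0, min_le_left _ _, α, hα0, fun t ht => ?_⟩
  have htδ : t ∈ Ioo (t₁ - δ) (t₁ + δ) := by
    rw [← Real.ball_eq_Ioo]; exact ht.2
  have h1 := (hα t (Ioo_subset_Icc_self htδ)).hasDerivAt (Icc_mem_nhds htδ.1 htδ.2)
  rw [hST t (by
    rw [← hcd]
    exact ⟨ht.1, by
      rw [Real.closedBall_eq_Icc]; exact hsub (Ioo_subset_Icc_self htδ)⟩)] at h1
  exact h1.hasDerivWithinAt

/-- `Θ` is the matrix of a basis of solutions of `y' = A y` near `U`, and `Ψ` is its inverse. -/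
structure IsPropagator (A : ℝ → F →L[ℝ] F) (J U : Set ℝ) (Θ Ψ : ℝ → F →L[ℝ] F) : Prop where
  hasDerivWithinAt : ∀ t ∈ U, HasDerivWithinAt Θ ((A t).comp (Θ t)) J t
  hasDerivWithinAt_inv : ∀ t ∈ U, HasDerivWithinAt Ψ (-(Ψ t).comp (A t)) J t
  left_inv : ∀ t ∈ U, ∀ v, Ψ t (Θ t v) = v
  right_inv : ∀ t ∈ U, ∀ v, Θ t (Ψ t v) = v

theorem eq_of_hasDerivWithinAt_zero {f : ℝ → F} {S : Set ℝ} (hS : S.OrdConnected)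
    (hf : ∀ t ∈ S, HasDerivWithinAt f 0 S t) {s t : ℝ} (hs : s ∈ S) (ht : t ∈ S) : f s = f t := by
  have := hS.convex.norm_image_sub_le_of_norm_hasDerivWithin_le (f' := fun _ => (0 : F)) (C := 0)
    (fun x hx => hf x hx) (by simp) ht hs
  rw [zero_mul] at this
  exact sub_eq_zero.1 (norm_le_zero_iff.1 this)

/-- The matrix equations `Θ' = A Θ` and `Ψ' = -Ψ A` are themselves linear. The derivative of `Ψ Θ`
vanishes, so `Ψ` is a left inverse of `Θ`, hence a two-sided one in finite dimension. -/
theorem exists_isPropagator [FiniteDimensional ℝ F] {a b t₁ r : ℝ} (hr : 0 < r)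
    (ht₁ : t₁ ∈ Icc a b) {A : ℝ → F →L[ℝ] F}
    (hA : ContinuousOn A (Icc a b ∩ Metric.closedBall t₁ r)) :
    ∃ δ > 0, δ ≤ r ∧ ∃ Θ Ψ : ℝ → F →L[ℝ] F, Ψ t₁ = ContinuousLinearMap.id ℝ F ∧
      IsPropagator A (Icc a b) (Icc a b ∩ Metric.ball t₁ δ) Θ Ψ := by
  have : CompleteSpace F := FiniteDimensional.complete ℝ F
  obtain ⟨δ₁, h₁, hr₁, Θ, hΘ0, hΘ⟩ := exists_solution_linear hr ht₁
    (T := fun t => ContinuousLinearMap.compL ℝ F F F (A t))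
    ((ContinuousLinearMap.compL ℝ F F F).continuous.comp_continuousOn hA)
    (ContinuousLinearMap.id ℝ F)
  obtain ⟨δ₂, h₂, hr₂, Ψ, hΨ0, hΨ⟩ := exists_solution_linear hr ht₁
    (T := fun t => -(ContinuousLinearMap.compL ℝ F F F).flip (A t))
    ((ContinuousLinearMap.compL ℝ F F F).flip.continuous.comp_continuousOn hA).neg
    (ContinuousLinearMap.id ℝ F)
  have hb : Icc a b ∩ Metric.ball t₁ (min δ₁ δ₂) =
      (Icc a b ∩ Metric.ball t₁ δ₁) ∩ (Icc a b ∩ Metric.ball t₁ δ₂) := by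
    ext t
    simp only [mem_inter_iff, Metric.mem_ball, lt_min_iff]
    tauto
  refine ⟨min δ₁ δ₂, lt_min h₁ h₂, (min_le_left _ _).trans hr₁, Θ, Ψ, hΨ0, ?_⟩
  have hd1 : ∀ t ∈ Icc a b ∩ Metric.ball t₁ (min δ₁ δ₂),
      HasDerivWithinAt Θ ((A t).comp (Θ t)) (Icc a b) t := fun t ht => by
    rw [hb] at ht
    exact hΘ t ht.1
  have hd2 : ∀ t ∈ Icc a b ∩ Metric.ball t₁ (min δ₁ δ₂),
      HasDerivWithinAt Ψ (-(Ψ t).comp (A t)) (Icc a b) t := fun t ht => by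
    rw [hb] at ht
    exact hΨ t ht.2
  have hconst : ∀ t ∈ Icc a b ∩ Metric.ball t₁ (min δ₁ δ₂),
      (Ψ t).comp (Θ t) = ContinuousLinearMap.id ℝ F := by
    intro t ht
    have hord : (Icc a b ∩ Metric.ball t₁ (min δ₁ δ₂)).OrdConnected := by
      rw [Real.ball_eq_Ioo]; exact ordConnected_Icc.inter ordConnected_Ioo
    have h0 : t₁ ∈ Icc a b ∩ Metric.ball t₁ (min δ₁ δ₂) :=
      ⟨ht₁, Metric.mem_ball_self (lt_min h₁ h₂)⟩
    rw [eq_of_hasDerivWithinAt_zero (f := fun t => (Ψ t).comp (Θ t)) hord (fun s hs => ?_) ht h0]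
    · simp only [hΨ0, hΘ0, ContinuousLinearMap.id_comp]
    · refine (((hd2 s hs).clm_comp (hd1 s hs)).mono inter_subset_left).congr_deriv ?_
      ext v
      simp
  have hl : ∀ t ∈ Icc a b ∩ Metric.ball t₁ (min δ₁ δ₂), ∀ v, Ψ t (Θ t v) = v := fun t ht v =>
    congrArg (fun L : F →L[ℝ] F => L v) (hconst t ht)
  refine ⟨hd1, hd2, hl, fun t ht v => ?_⟩
  obtain ⟨u, rfl⟩ := (LinearMap.injective_iff_surjective (f := (Θ t : F →ₗ[ℝ] F))).1
    (Function.LeftInverse.injective (hl t ht)) v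
  exact congrArg (Θ t) (hl t ht u)

namespace IsPropagator

variable {A : ℝ → F →L[ℝ] F} {J U : Set ℝ} {Θ Ψ : ℝ → F →L[ℝ] F}

theorem hasDerivWithinAt_apply (h : IsPropagator A J U Θ Ψ) {t : ℝ} (ht : t ∈ U) (v : F) :
    HasDerivWithinAt (fun s => Θ s v) (A t (Θ t v)) J t :=
  ((h.hasDerivWithinAt t ht).clm_apply (hasDerivWithinAt_const t J v)).congr_deriv (by simp)

/-- Since `Ψ' = -Ψ A`, the derivative of `Ψ y` along a solution `y` is zero. This yields uniqueness,
and later the description of transport to a fixed time. -/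
theorem apply_eq_apply (h : IsPropagator A J U Θ Ψ) {S : Set ℝ} (hS : S.OrdConnected)
    (hSU : S ⊆ U) (hSJ : S ⊆ J) {y : ℝ → F}
    (hy : ∀ t ∈ S, HasDerivWithinAt y (A t (y t)) J t) {s t : ℝ} (hs : s ∈ S) (ht : t ∈ S) :
    Ψ s (y s) = Ψ t (y t) := by
  refine eq_of_hasDerivWithinAt_zero (f := fun t => Ψ t (y t)) hS (fun r hr => ?_) hs ht
  refine (((h.hasDerivWithinAt_inv r (hSU hr)).clm_apply (hy r hr)).mono hSJ).congr_deriv ?_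
  simp

theorem eq_apply (h : IsPropagator A J U Θ Ψ) {S : Set ℝ} (hS : S.OrdConnected)
    (hSU : S ⊆ U) (hSJ : S ⊆ J) {y : ℝ → F}
    (hy : ∀ t ∈ S, HasDerivWithinAt y (A t (y t)) J t) {s t : ℝ} (hs : s ∈ S) (ht : t ∈ S) :
    y s = Θ s (Ψ t (y t)) := by
  rw [← h.apply_eq_apply hS hSU hSJ hy hs ht, h.right_inv s (hSU hs)]

end IsPropagator

end LinearODE

end

/-! ### Local existence of parallel sections -/

section

variable {E : Type*} [NormedAddCommGroup E] [NormedSpace ℝ E]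
  {M : Type*} [TopologicalSpace M] [ChartedSpace E M] [IsManifold 𝓘(ℝ, E) ∞ M]
  {H K : ∀ p : M, Submodule ℝ (TangentSpace 𝓘(ℝ, E) p)}

theorem eventually_mem_chart_source {A X : Type*} [TopologicalSpace A] [TopologicalSpace X]
    [ChartedSpace A X] {p₀ : X} {β : ℝ → X} {J : Set ℝ} {t : ℝ} (hβ : ContinuousWithinAt β J t)
    (hp : β t ∈ (chartAt A p₀).source) : ∀ᶠ s in 𝓝[J] t, β s ∈ (chartAt A p₀).source :=
  hβ.preimage_mem_nhdsWithin ((chartAt A p₀).open_source.mem_nhds hp)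

/-- The velocity of `β` in the preferred chart at `p₀`. -/
def speedCoord (p₀ : M) (β : ℝ → M) (J : Set ℝ) (t : ℝ) : E :=
  fibreCoord p₀ (β t) (velocity β J t)

section Curve

variable {p₀ : M} {β : ℝ → M} {J : Set ℝ} {t : ℝ}

theorem contDiffWithinAt_extChartAt_comp (hβ : ContMDiffWithinAt 𝓘(ℝ, ℝ) 𝓘(ℝ, E) ∞ β J t)
    (hp : β t ∈ (chartAt E p₀).source) :
    ContDiffWithinAt ℝ ∞ (fun s => extChartAt 𝓘(ℝ, E) p₀ (β s)) J t :=
  ((contMDiffAt_extChartAt' hp).comp_contMDiffWithinAt t hβ).contDiffWithinAt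

theorem contDiffWithinAt_speedCoord (hJ : UniqueDiffOn ℝ J)
    (hβ : ContMDiffOn 𝓘(ℝ, ℝ) 𝓘(ℝ, E) ∞ β J) (ht : t ∈ J)
    (hp : β t ∈ (chartAt E p₀).source) :
    ContDiffWithinAt ℝ ∞ (speedCoord (E := E) p₀ β J) J t := by
  have h1 : ContDiffWithinAt ℝ ∞
      (derivWithin (fun s => extChartAt 𝓘(ℝ, E) p₀ (β s)) J) J t :=
    (contDiffWithinAt_extChartAt_comp (hβ t ht) hp).derivWithin hJ (by norm_cast) ht
  have h2 : ∀ s ∈ J, β s ∈ (chartAt E p₀).source → speedCoord (E := E) p₀ β J s =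
      derivWithin (fun s => extChartAt 𝓘(ℝ, E) p₀ (β s)) J s := fun s hs hps =>
    ((hasDerivWithinAt_extChartAt_comp ((hβ s hs).mdifferentiableWithinAt (by simp))
      hps).derivWithin (hJ s hs)).symm
  refine h1.congr_of_eventuallyEq ?_ (h2 t ht hp)
  filter_upwards [eventually_mem_chart_source (hβ t ht).continuousWithinAt hp,
    self_mem_nhdsWithin] with s hs hsJ using h2 s hsJ hs

theorem contDiffWithinAt_comp_extChartAt {G : Type*} [NormedAddCommGroup G] [NormedSpace ℝ G]
    {f : E → G} (hβ : ContMDiffWithinAt 𝓘(ℝ, ℝ) 𝓘(ℝ, E) ∞ β J t)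
    (hp : β t ∈ (chartAt E p₀).source) (hf : ContDiffAt ℝ ∞ f (extChartAt 𝓘(ℝ, E) p₀ (β t))) :
    ContDiffWithinAt ℝ ∞ (fun s => f (extChartAt 𝓘(ℝ, E) p₀ (β s))) J t :=
  hf.comp_contDiffWithinAt (f := fun s => extChartAt 𝓘(ℝ, E) p₀ (β s)) t
    (contDiffWithinAt_extChartAt_comp hβ hp)

end Curve

namespace IsProjectionChart

variable {p₀ : M} {V : Set E} {π : E → E →L[ℝ] E}

theorem contDiffAt_fderiv (h : IsProjectionChart H K p₀ V π) {x : E} (hx : x ∈ V) :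
    ContDiffAt ℝ ∞ (fderiv ℝ π) x :=
  (h.left.contDiffAt hx).fderiv_right (by norm_cast)

theorem eventually_mem (h : IsProjectionChart H K p₀ V π) {β : ℝ → M} {J : Set ℝ} {t : ℝ}
    (hβ : ContMDiffWithinAt 𝓘(ℝ, ℝ) 𝓘(ℝ, E) ∞ β J t) (hp : β t ∈ (chartAt E p₀).source)
    (hV : extChartAt 𝓘(ℝ, E) p₀ (β t) ∈ V) :
    ∀ᶠ s in 𝓝[J] t, β s ∈ (chartAt E p₀).source ∧ extChartAt 𝓘(ℝ, E) p₀ (β s) ∈ V :=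
  (eventually_mem_chart_source hβ.continuousWithinAt hp).and
    ((contDiffWithinAt_extChartAt_comp hβ hp).continuousWithinAt.preimage_mem_nhdsWithin
      (h.left.isOpen.mem_nhds hV))

/-- Near every time, the equation of parallel sections has a propagator, and its solutions stay in
`K`. -/
theorem exists_local_parallel [FiniteDimensional ℝ E] (h : IsProjectionChart H K p₀ V π)
    {β : ℝ → M} {a b t₁ : ℝ} (hab : a < b)
    (hβ : ContMDiffOn 𝓘(ℝ, ℝ) 𝓘(ℝ, E) ∞ β (Icc a b))
    (hβH : ∀ t ∈ Icc a b, velocity β (Icc a b) t ∈ H (β t)) (ht₁ : t₁ ∈ Icc a b)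
    (hp : β t₁ ∈ (chartAt E p₀).source) (hV : extChartAt 𝓘(ℝ, E) p₀ (β t₁) ∈ V) :
    ∃ δ > 0, ∃ Θ Ψ : ℝ → E →L[ℝ] E, Ψ t₁ = ContinuousLinearMap.id ℝ E ∧
      IsPropagator (fun t => connectionCoeff π (extChartAt 𝓘(ℝ, E) p₀ (β t))
        (speedCoord p₀ β (Icc a b) t)) (Icc a b) (Icc a b ∩ Metric.ball t₁ δ) Θ Ψ ∧
      (∀ t ∈ Icc a b ∩ Metric.ball t₁ δ,
        β t ∈ (chartAt E p₀).source ∧ extChartAt 𝓘(ℝ, E) p₀ (β t) ∈ V) ∧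
      ∀ s ∈ Icc a b ∩ Metric.ball t₁ δ, ∀ k : K (β s), ∃ σ : ∀ t : ℝ, K (β t), σ s = k ∧
        ∀ t ∈ Icc a b ∩ Metric.ball t₁ δ, IsParallelAt H K β (Icc a b) σ t := by
  have hJ := uniqueDiffOn_Icc hab
  obtain ⟨r', hr', hr''⟩ := Metric.mem_nhdsWithin_iff.1 (h.eventually_mem (hβ t₁ ht₁) hp hV)
  set r := r' / 2 with hr
  have hr0 : 0 < r := half_pos hr'
  have hgood : ∀ t ∈ Icc a b ∩ Metric.closedBall t₁ r,
      β t ∈ (chartAt E p₀).source ∧ extChartAt 𝓘(ℝ, E) p₀ (β t) ∈ V := fun t ht =>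
    hr'' ⟨Metric.closedBall_subset_ball (half_lt_self hr') ht.2, ht.1⟩
  set x : ℝ → E := fun t => extChartAt 𝓘(ℝ, E) p₀ (β t) with hx
  set v : ℝ → E := speedCoord p₀ β (Icc a b) with hv
  have hB : ∀ t ∈ Icc a b ∩ Metric.closedBall t₁ r,
      ContDiffWithinAt ℝ ∞ (fun t => fderiv ℝ π (x t) (v t)) (Icc a b) t := fun t ht =>
    (contDiffWithinAt_comp_extChartAt (hβ t ht.1) (hgood t ht).1
      (h.contDiffAt_fderiv (hgood t ht).2)).clm_apply
      (contDiffWithinAt_speedCoord hJ hβ ht.1 (hgood t ht).1)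
  have hB' : ∀ t ∈ Icc a b ∩ Metric.closedBall t₁ r,
      ContDiffWithinAt ℝ ∞ (fun t => (fderiv ℝ π (x t)).flip (v t)) (Icc a b) t := fun t ht =>
    ((ContinuousLinearMap.flipₗᵢ ℝ E E E).contDiff.contDiffAt.comp_contDiffWithinAt t
      (contDiffWithinAt_comp_extChartAt (hβ t ht.1) (hgood t ht).1
      (h.contDiffAt_fderiv (hgood t ht).2))).clm_apply
      (contDiffWithinAt_speedCoord hJ hβ ht.1 (hgood t ht).1)
  have hA : ContinuousOn (fun t => connectionCoeff π (x t) (v t))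
      (Icc a b ∩ Metric.closedBall t₁ r) := fun t ht =>
    ((hB t ht).continuousWithinAt.sub (hB' t ht).continuousWithinAt).mono inter_subset_left
  have hBc : ContinuousOn (fun t => -fderiv ℝ π (x t) (v t))
      (Icc a b ∩ Metric.closedBall t₁ r) := fun t ht =>
    (hB t ht).continuousWithinAt.neg.mono inter_subset_left
  obtain ⟨δ₁, h₁, hr₁, Θ, Ψ, hΨ, hprop⟩ := exists_isPropagator hr0 ht₁ hA
  -- This second equation is the one satisfied by the defect `y - π y`; its uniqueness theorem will
  -- keep solutions inside `K`.
  obtain ⟨δ₂, h₂, hr₂, Θ', Ψ', -, hprop'⟩ := exists_isPropagator hr0 ht₁ hBc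
  set δ := min δ₁ δ₂ with hδ
  have hsub1 : Icc a b ∩ Metric.ball t₁ δ ⊆ Icc a b ∩ Metric.ball t₁ δ₁ :=
    inter_subset_inter_right _ (Metric.ball_subset_ball (min_le_left _ _))
  have hsub2 : Icc a b ∩ Metric.ball t₁ δ ⊆ Icc a b ∩ Metric.ball t₁ δ₂ :=
    inter_subset_inter_right _ (Metric.ball_subset_ball (min_le_right _ _))
  have hsub3 : Icc a b ∩ Metric.ball t₁ δ ⊆ Icc a b ∩ Metric.closedBall t₁ r :=
    hsub1.trans (inter_subset_inter_right _
      ((Metric.ball_subset_ball hr₁).trans Metric.ball_subset_closedBall))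
  have hord : (Icc a b ∩ Metric.ball t₁ δ).OrdConnected := by
    rw [Real.ball_eq_Ioo]; exact ordConnected_Icc.inter ordConnected_Ioo
  have hprop1 : IsPropagator (fun t => connectionCoeff π (x t) (v t)) (Icc a b)
      (Icc a b ∩ Metric.ball t₁ δ) Θ Ψ :=
    ⟨fun t ht => hprop.1 t (hsub1 ht), fun t ht => hprop.2 t (hsub1 ht),
      fun t ht => hprop.3 t (hsub1 ht), fun t ht => hprop.4 t (hsub1 ht)⟩
  refine ⟨δ, lt_min h₁ h₂, Θ, Ψ, hΨ, hprop1, fun t ht => hgood t (hsub3 ht), fun s hs k => ?_⟩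
  set y : ℝ → E := fun t => Θ t (Ψ s (fibreCoord p₀ (β s) (k : TangentSpace 𝓘(ℝ, E) (β s)))) with hy
  have hyd : ∀ t ∈ Icc a b ∩ Metric.ball t₁ δ,
      HasDerivWithinAt y (connectionCoeff π (x t) (v t) (y t)) (Icc a b) t := fun t ht =>
    hprop1.hasDerivWithinAt_apply ht _
  have hys : y s = fibreCoord p₀ (β s) (k : TangentSpace 𝓘(ℝ, E) (β s)) :=
    hprop1.right_inv s hs (fibreCoord p₀ (β s) (k : TangentSpace 𝓘(ℝ, E) (β s)))
  -- With `v ∈ H`, both sides equal `-π Dπ(v) y`, by the differentiated identity `π² = π`.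
  have hτd : ∀ t ∈ Icc a b ∩ Metric.ball t₁ δ, HasDerivWithinAt (fun t => y t - π (x t) (y t))
      ((-fderiv ℝ π (x t) (v t)) (y t - π (x t) (y t))) (Icc a b) t := by
    intro t ht
    obtain ⟨hpt, hVt⟩ := hgood t (hsub3 ht)
    have hxd : HasDerivWithinAt x (v t) (Icc a b) t :=
      hasDerivWithinAt_extChartAt_comp ((hβ t ht.1).mdifferentiableWithinAt (by simp)) hpt
    have hπd : HasDerivWithinAt (fun t => π (x t)) (fderiv ℝ π (x t) (v t)) (Icc a b) t :=
      (h.left.hasFDerivAt hVt).comp_hasDerivWithinAt t hxd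
    have hv0 : π (x t) (v t) = 0 := (h.left.mem_iff _ hpt hVt _).1 (hβH t ht.1)
    have e1 : π (x t) (fderiv ℝ π (x t) (y t) (v t)) = fderiv ℝ π (x t) (y t) (v t) := by
      have := h.fderiv_idem hVt (y t) (v t)
      rwa [hv0, map_zero, zero_add] at this
    have e2 : fderiv ℝ π (x t) (v t) (π (x t) (y t)) = fderiv ℝ π (x t) (v t) (y t) -
        π (x t) (fderiv ℝ π (x t) (v t) (y t)) :=
      eq_sub_of_add_eq (h.fderiv_idem hVt (v t) (y t))
    refine ((hyd t ht).sub (hπd.clm_apply (hyd t ht))).congr_deriv ?_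
    rw [connectionCoeff_apply, map_sub, map_sub, e1, neg_apply, neg_apply, e2]
    abel
  have hs0 : y s - π (x s) (y s) = 0 := by
    obtain ⟨hps, hVs⟩ := hgood s (hsub3 hs)
    rw [hys, sub_eq_zero]
    exact ((h.mem_right_iff hps hVs _).1 k.2).symm
  have hτ : ∀ t ∈ Icc a b ∩ Metric.ball t₁ δ, π (x t) (y t) = y t := by
    intro t ht
    have := hprop'.eq_apply hord hsub2 inter_subset_left hτd ht hs
    rw [hs0, map_zero, map_zero, sub_eq_zero] at this
    exact this.symm
  have hmem : ∀ t ∈ Icc a b ∩ Metric.ball t₁ δ, fibreCoordSymm p₀ (β t) (y t) ∈ K (β t) := by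
    intro t ht
    obtain ⟨hpt, hVt⟩ := hgood t (hsub3 ht)
    rw [h.mem_right_iff hpt hVt, fibreCoord_fibreCoordSymm hpt]
    exact hτ t ht
  classical
  set σ : ∀ t : ℝ, K (β t) := fun t =>
    if hm : fibreCoordSymm p₀ (β t) (y t) ∈ K (β t) then ⟨_, hm⟩ else 0 with hσ
  have hσv : ∀ t ∈ Icc a b ∩ Metric.ball t₁ δ,
      (σ t : TangentSpace 𝓘(ℝ, E) (β t)) = fibreCoordSymm p₀ (β t) (y t) := by
    intro t ht
    rw [hσ]
    simp only [dif_pos (hmem t ht)]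
  have hσy : ∀ t ∈ Icc a b ∩ Metric.ball t₁ δ,
      fibreCoord p₀ (β t) (σ t : TangentSpace 𝓘(ℝ, E) (β t)) = y t := by
    intro t ht
    exact (congrArg (fibreCoord p₀ (β t)) (hσv t ht)).trans
      (fibreCoord_fibreCoordSymm (hgood t (hsub3 ht)).1 _)
  refine ⟨σ, Subtype.ext ?_, fun t ht => ?_⟩
  · rw [hσv s hs, hys, fibreCoordSymm_fibreCoord (hgood s (hsub3 hs)).1]
  · obtain ⟨hpt, hVt⟩ := hgood t (hsub3 ht)
    rw [h.isParallelAt_iff (hJ t ht.1) ((hβ t ht.1).mdifferentiableWithinAt (by simp))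
      (hβH t ht.1) hpt hVt, hσy t ht]
    refine (hyd t ht).congr_of_eventuallyEq ?_ (hσy t ht)
    filter_upwards [inter_mem_nhdsWithin (Icc a b) (Metric.isOpen_ball.mem_nhds ht.2)] with s hs
      using hσy s hs

end IsProjectionChart

end

/-! ### Patching local solutions over a compact interval -/

section

section Patching

variable {V : ℝ → Type*} {P : (∀ t, V t) → ℝ → Prop} {a b δ : ℝ}

/-- Equality propagates from `s` in steps of length at most `δ / 2`, each inside a ball where
uniqueness is known. -/
theorem eq_of_local_uniqueness (hδ : 0 < δ)
    (huniq : ∀ t₁ ∈ Icc a b, ∀ (σ σ' : ∀ t, V t) (S : Set ℝ), S.OrdConnected →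
      S ⊆ Icc a b ∩ Metric.ball t₁ δ → (∀ t ∈ S, P σ t) → (∀ t ∈ S, P σ' t) →
      ∀ s ∈ S, σ s = σ' s → ∀ t ∈ S, σ t = σ' t)
    {σ σ' : ∀ t, V t} {S : Set ℝ} (hS : S.OrdConnected) (hSJ : S ⊆ Icc a b)
    (hσ : ∀ t ∈ S, P σ t) (hσ' : ∀ t ∈ S, P σ' t) {s t : ℝ} (hs : s ∈ S) (ht : t ∈ S)
    (h : σ s = σ' s) : σ t = σ' t := by
  have key : ∀ n : ℕ, ∀ t ∈ S, |t - s| ≤ n * (δ / 2) → σ t = σ' t := by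
    intro n
    induction n with
    | zero =>
      intro t _ hts
      obtain rfl : t = s := by
        rw [Nat.cast_zero, zero_mul] at hts
        exact sub_eq_zero.1 (abs_eq_zero.1 (le_antisymm hts (abs_nonneg _)))
      exact h
    | succ n ih =>
      intro t ht hts
      have hn : (0 : ℝ) < n + 1 := by positivity
      -- The point dividing the segment from `s` to `t` in the ratio `n : 1`: within `n * (δ / 2)`
      -- of `s` and `δ / 2` of `t`.
      set u : ℝ := s + (n / (n + 1)) * (t - s) with hu
      have hfrac : (n : ℝ) / (n + 1) ∈ Icc (0 : ℝ) 1 :=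
        ⟨by positivity, (div_le_one hn).2 (by linarith)⟩
      have huS : u ∈ S := by
        have := hS.convex hs ht (sub_nonneg.2 hfrac.2) hfrac.1 (by ring)
        simp only [smul_eq_mul] at this
        convert! this using 1
        rw [hu]; ring
      push_cast at hts
      have hus : |u - s| ≤ n * (δ / 2) := by
        rw [hu, add_sub_cancel_left, abs_mul, abs_of_nonneg hfrac.1, div_mul_eq_mul_div,
          div_le_iff₀ hn]
        nlinarith [mul_le_mul_of_nonneg_left hts (Nat.cast_nonneg (α := ℝ) n)]
      have hut : |t - u| ≤ δ / 2 := by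
        have : t - u = (t - s) / (n + 1) := by
          rw [hu]; field_simp; ring
        rw [this, abs_div, abs_of_pos hn, div_le_iff₀ hn]
        linarith
      have hsub : uIcc u t ⊆ S := hS.uIcc_subset huS ht
      have hball : uIcc u t ⊆ Metric.ball u δ := by
        intro r hr
        rw [Metric.mem_ball, Real.dist_eq]
        have := abs_sub_left_of_mem_uIcc hr
        linarith
      exact huniq u (hSJ huS) σ σ' (uIcc u t) ordConnected_uIcc
        (subset_inter (hsub.trans hSJ) hball) (fun r hr => hσ r (hsub hr))
        (fun r hr => hσ' r (hsub hr)) u left_mem_uIcc (ih u huS hus) t right_mem_uIcc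
  obtain ⟨n, hn⟩ := exists_nat_ge (|t - s| / (δ / 2))
  exact key n t ht ((div_le_iff₀ (half_pos hδ)).1 hn)

/-- Because local solutions exist on balls of one common radius `δ`, a solution on the ball of
radius `r` about `s` can be prolonged at both ends, gaining `δ / 2` each time. Finitely many
prolongations cover `[a, b]`. -/
theorem exists_of_local_existence (hδ : 0 < δ)
    (hcongr : ∀ (σ σ' : ∀ t, V t), ∀ t ∈ Icc a b, (∀ᶠ s in 𝓝[Icc a b] t, σ s = σ' s) →
      P σ t → P σ' t)
    (hex : ∀ s ∈ Icc a b, ∀ k : V s, ∃ σ : ∀ t, V t, σ s = k ∧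
      ∀ t ∈ Icc a b ∩ Metric.ball s δ, P σ t)
    (huniq : ∀ t₁ ∈ Icc a b, ∀ (σ σ' : ∀ t, V t) (S : Set ℝ), S.OrdConnected →
      S ⊆ Icc a b ∩ Metric.ball t₁ δ → (∀ t ∈ S, P σ t) → (∀ t ∈ S, P σ' t) →
      ∀ s ∈ S, σ s = σ' s → ∀ t ∈ S, σ t = σ' t)
    {s : ℝ} (hs : s ∈ Icc a b) (k : V s) : ∃ σ : ∀ t, V t, σ s = k ∧ ∀ t ∈ Icc a b, P σ t := by
  have key : ∀ n : ℕ, ∃ σ : ∀ t, V t, σ s = k ∧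
      ∀ t ∈ Icc a b, |t - s| < (n + 1) * (δ / 2) → P σ t := by
    intro n
    induction n with
    | zero =>
      obtain ⟨σ, h1, h2⟩ := hex s hs k
      refine ⟨σ, h1, fun t ht hts => h2 t ⟨ht, ?_⟩⟩
      rw [Metric.mem_ball, Real.dist_eq]
      rw [Nat.cast_zero] at hts
      linarith
    | succ n ih =>
      obtain ⟨σ, hσs, hσ⟩ := ih
      set r : ℝ := (n + 1) * (δ / 2) with hr
      have hrδ : δ / 2 ≤ r := by
        rw [hr]
        nlinarith [Nat.cast_nonneg (α := ℝ) n]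
      -- continuation of `σ` across a point `c`
      have hcont : ∀ c ∈ Icc a b, |c - s| < r → ∃ τ : ∀ t, V t,
          (∀ t ∈ Icc a b, |t - c| < δ → P τ t) ∧
          ∀ t ∈ Icc a b, |t - s| < r → |t - c| < δ → τ t = σ t := by
        intro c hc hcs
        obtain ⟨τ, hτc, hτ⟩ := hex c hc (σ c)
        refine ⟨τ, fun t ht h => hτ t ⟨ht, by rwa [Metric.mem_ball, Real.dist_eq]⟩,
          fun t ht h h' => ?_⟩
        have hord : (Icc a b ∩ Metric.ball s r ∩ Metric.ball c δ).OrdConnected := by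
          rw [Real.ball_eq_Ioo, Real.ball_eq_Ioo]
          exact (ordConnected_Icc.inter ordConnected_Ioo).inter ordConnected_Ioo
        refine huniq c hc τ σ _ hord (fun u hu => ⟨hu.1.1, hu.2⟩)
          (fun u hu => hτ u ⟨hu.1.1, hu.2⟩)
          (fun u hu => hσ u hu.1.1 (by simpa [Real.dist_eq] using hu.1.2)) c
          ⟨⟨hc, by rwa [Metric.mem_ball, Real.dist_eq]⟩, Metric.mem_ball_self hδ⟩ hτc t
          ⟨⟨ht, by rwa [Metric.mem_ball, Real.dist_eq]⟩, by rwa [Metric.mem_ball, Real.dist_eq]⟩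
      -- Restarting `δ / 4` inside the known domain reaches `r + 3δ / 4 > r + δ / 2`, with an
      -- overlap on which old and new solutions agree. If `c₁` or `c₂` falls outside `[a, b]`, there
      -- is nothing to prolong on that side.
      set c₁ := s + (r - δ / 4) with hc₁
      set c₂ := s - (r - δ / 4) with hc₂
      obtain ⟨τ₁, h₁, h₁'⟩ : ∃ τ : ∀ t, V t,
          (∀ t ∈ Icc a b, c₁ ≤ t → |t - c₁| < δ → P τ t) ∧
          ∀ t ∈ Icc a b, |t - s| < r → |t - c₁| < δ → τ t = σ t := by
        by_cases hc : c₁ ∈ Icc a b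
        · obtain ⟨τ, h, h'⟩ := hcont c₁ hc (by
            rw [hc₁, add_sub_cancel_left, abs_of_nonneg (by linarith)]; linarith)
          exact ⟨τ, fun t ht _ => h t ht, h'⟩
        · refine ⟨σ, fun t ht hle => absurd ⟨?_, hle.trans ht.2⟩ hc, fun _ _ _ _ => rfl⟩
          linarith [hs.1]
      obtain ⟨τ₂, h₂, h₂'⟩ : ∃ τ : ∀ t, V t,
          (∀ t ∈ Icc a b, t ≤ c₂ → |t - c₂| < δ → P τ t) ∧
          ∀ t ∈ Icc a b, |t - s| < r → |t - c₂| < δ → τ t = σ t := by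
        by_cases hc : c₂ ∈ Icc a b
        · obtain ⟨τ, h, h'⟩ := hcont c₂ hc (by
            rw [hc₂, sub_sub_cancel_left, abs_neg, abs_of_nonneg (by linarith)]; linarith)
          exact ⟨τ, fun t ht _ => h t ht, h'⟩
        · refine ⟨σ, fun t ht hle => absurd ⟨ht.1.trans hle, ?_⟩ hc, fun _ _ _ _ => rfl⟩
          linarith [hs.2]
      set σ' : ∀ t, V t := fun t => if c₁ ≤ t then τ₁ t else if t ≤ c₂ then τ₂ t else σ t with hσ'
      refine ⟨σ', ?_, fun t ht hts => ?_⟩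
      · rw [hσ']
        simp only
        rw [if_neg (by linarith), if_neg (by linarith)]
        exact hσs
      push_cast at hts
      have hts' : |t - s| < r + δ / 2 := by rw [hr]; linarith
      obtain ⟨hts1, hts2⟩ := abs_lt.1 hts'
      by_cases ht1 : c₁ ≤ t
      · refine hcongr τ₁ σ' t ht ?_ (h₁ t ht ht1 (abs_lt.2 ⟨by linarith, by linarith⟩))
        filter_upwards [self_mem_nhdsWithin, nhdsWithin_le_nhds (Ioi_mem_nhds
          (show max c₂ (c₁ - δ) < t from max_lt (by linarith) (by linarith)))] with u hu hu'
        obtain ⟨hu1, hu2⟩ := max_lt_iff.1 (mem_Ioi.1 hu')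
        rw [hσ']
        simp only
        by_cases hcu : c₁ ≤ u
        · rw [if_pos hcu]
        · rw [if_neg hcu, if_neg (not_le.2 hu1)]
          exact h₁' u hu (abs_lt.2 ⟨by linarith, by linarith⟩)
            (abs_lt.2 ⟨by linarith, by linarith⟩)
      by_cases ht2 : t ≤ c₂
      · refine hcongr τ₂ σ' t ht ?_ (h₂ t ht ht2 (abs_lt.2 ⟨by linarith, by linarith⟩))
        filter_upwards [self_mem_nhdsWithin, nhdsWithin_le_nhds (Iio_mem_nhds
          (show t < min c₁ (c₂ + δ) from lt_min (by linarith) (by linarith)))] with u hu hu'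
        obtain ⟨hu1, hu2⟩ := lt_min_iff.1 (mem_Iio.1 hu')
        rw [hσ']
        simp only
        rw [if_neg (not_le.2 hu1)]
        by_cases hcu : u ≤ c₂
        · rw [if_pos hcu]
        · rw [if_neg hcu]
          exact h₂' u hu (abs_lt.2 ⟨by linarith, by linarith⟩)
            (abs_lt.2 ⟨by linarith, by linarith⟩)
      · rw [not_le] at ht1 ht2
        refine hcongr σ σ' t ht ?_ (hσ t ht (abs_lt.2 ⟨by linarith, by linarith⟩))
        filter_upwards [nhdsWithin_le_nhds (Ioo_mem_nhds ht2 ht1)] with u hu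
        rw [hσ']
        simp only
        rw [if_neg (not_le.2 hu.2), if_neg (not_le.2 hu.1)]
  obtain ⟨n, hn⟩ := exists_nat_gt ((b - a) / (δ / 2))
  obtain ⟨σ, h1, h2⟩ := key n
  refine ⟨σ, h1, fun t ht => h2 t ht ?_⟩
  have h3 : b - a < n * (δ / 2) := (div_lt_iff₀ (half_pos hδ)).1 hn
  have h4 : |t - s| ≤ b - a := abs_le.2 ⟨by linarith [ht.1, hs.2], by linarith [ht.2, hs.1]⟩
  linarith

end Patching

end

/-! ### Parallel transport over the whole interval -/

section

variable {E : Type*} [NormedAddCommGroup E] [NormedSpace ℝ E]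
  {M : Type*} [TopologicalSpace M] [ChartedSpace E M] [IsManifold 𝓘(ℝ, E) ∞ M]
  {H K : ∀ p : M, Submodule ℝ (TangentSpace 𝓘(ℝ, E) p)}

/-- `β` is a smooth path, defined on `[a, b]` and tangent to `H`. -/
structure IsHorizontalPath (H : ∀ p : M, Submodule ℝ (TangentSpace 𝓘(ℝ, E) p)) (β : ℝ → M)
    (a b : ℝ) : Prop where
  lt : a < b
  contMDiffOn : ContMDiffOn 𝓘(ℝ, ℝ) 𝓘(ℝ, E) ∞ β (Icc a b)
  velocity_mem : ∀ t ∈ Icc a b, velocity β (Icc a b) t ∈ H (β t)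

namespace IsHorizontalPath

variable {β : ℝ → M} {a b : ℝ}

theorem isParallelAt_iff (hβ : IsHorizontalPath H β a b) {p₀ : M} {V : Set E}
    {π : E → E →L[ℝ] E} (h : IsProjectionChart H K p₀ V π) {σ : ∀ t : ℝ, K (β t)} {t : ℝ}
    (ht : t ∈ Icc a b) (hp : β t ∈ (chartAt E p₀).source)
    (hV : extChartAt 𝓘(ℝ, E) p₀ (β t) ∈ V) :
    IsParallelAt H K β (Icc a b) σ t ↔
      HasDerivWithinAt (fun s => fibreCoord p₀ (β s) (σ s))
        (connectionCoeff π (extChartAt 𝓘(ℝ, E) p₀ (β t)) (speedCoord p₀ β (Icc a b) t)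
          (fibreCoord p₀ (β t) (σ t))) (Icc a b) t :=
  h.isParallelAt_iff (uniqueDiffOn_Icc hβ.lt t ht)
    ((hβ.contMDiffOn t ht).mdifferentiableWithinAt (by simp)) (hβ.velocity_mem t ht) hp hV

/-- In a chart the condition is a derivative at `t`, hence depends only on the germ of the section;
this is what gluing requires. -/
theorem isParallelAt_congr [FiniteDimensional ℝ E] (hβ : IsHorizontalPath H β a b)
    (hH : IsSmoothSubbundle H)
    (hK : IsSmoothSubbundle K) (hHK : ∀ p, IsCompl (H p) (K p)) {σ σ' : ∀ t : ℝ, K (β t)} {t : ℝ}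
    (ht : t ∈ Icc a b) (h : ∀ᶠ s in 𝓝[Icc a b] t, σ s = σ' s)
    (hσ : IsParallelAt H K β (Icc a b) σ t) : IsParallelAt H K β (Icc a b) σ' t := by
  obtain ⟨V, π, hV, hπ⟩ := exists_isProjectionChart hH hK hHK (β t)
  have hp : β t ∈ (chartAt E (β t)).source := mem_chart_source E (β t)
  have hσt : σ t = σ' t := h.self_of_nhdsWithin ht
  rw [hβ.isParallelAt_iff hπ ht hp hV] at hσ ⊢
  rw [← hσt]
  refine hσ.congr_of_eventuallyEq ?_ (by rw [hσt])
  filter_upwards [h] with s hs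
  rw [hs]

/-- Two local solutions of the equation of parallel sections coincide. -/
theorem eq_of_isPropagator (hβ : IsHorizontalPath H β a b) {p₀ : M} {V : Set E}
    {π : E → E →L[ℝ] E} (h : IsProjectionChart H K p₀ V π) {U : Set ℝ} (hUJ : U ⊆ Icc a b)
    (hU : ∀ t ∈ U, β t ∈ (chartAt E p₀).source ∧ extChartAt 𝓘(ℝ, E) p₀ (β t) ∈ V)
    {Θ Ψ : ℝ → E →L[ℝ] E}
    (hprop : IsPropagator (fun t => connectionCoeff π (extChartAt 𝓘(ℝ, E) p₀ (β t))
        (speedCoord p₀ β (Icc a b) t)) (Icc a b) U Θ Ψ)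
    {σ : ∀ t : ℝ, K (β t)} {S : Set ℝ} (hS : S.OrdConnected) (hSU : S ⊆ U)
    (hσ : ∀ t ∈ S, IsParallelAt H K β (Icc a b) σ t) {s t : ℝ} (hs : s ∈ S) (ht : t ∈ S) :
    Ψ s (fibreCoord p₀ (β s) (σ s : TangentSpace 𝓘(ℝ, E) (β s))) =
      Ψ t (fibreCoord p₀ (β t) (σ t : TangentSpace 𝓘(ℝ, E) (β t))) :=
  hprop.apply_eq_apply hS hSU (hSU.trans hUJ)
    (y := fun s => fibreCoord p₀ (β s) (σ s : TangentSpace 𝓘(ℝ, E) (β s)))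
    (fun r hr => (hβ.isParallelAt_iff h (hUJ (hSU hr)) (hU r (hSU hr)).1 (hU r (hSU hr)).2).1
      (hσ r hr)) hs ht

/-- The chartwise radii vary with the point; a Lebesgue number of the cover of `[a, b]` by the
corresponding balls replaces them by one radius. -/
theorem exists_local [FiniteDimensional ℝ E] (hβ : IsHorizontalPath H β a b)
    (hH : IsSmoothSubbundle H) (hK : IsSmoothSubbundle K) (hHK : ∀ p, IsCompl (H p) (K p)) :
    ∃ δ > 0,
      (∀ s ∈ Icc a b, ∀ k : K (β s), ∃ σ : ∀ t, K (β t), σ s = k ∧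
        ∀ t ∈ Icc a b ∩ Metric.ball s δ, IsParallelAt H K β (Icc a b) σ t) ∧
      ∀ t₁ ∈ Icc a b, ∀ (σ σ' : ∀ t, K (β t)) (S : Set ℝ), S.OrdConnected →
        S ⊆ Icc a b ∩ Metric.ball t₁ δ → (∀ t ∈ S, IsParallelAt H K β (Icc a b) σ t) →
        (∀ t ∈ S, IsParallelAt H K β (Icc a b) σ' t) →
        ∀ s ∈ S, σ s = σ' s → ∀ t ∈ S, σ t = σ' t := by
  have hloc : ∀ t₁ ∈ Icc a b, ∃ δ > 0,
      (∀ s ∈ Icc a b ∩ Metric.ball t₁ δ, ∀ k : K (β s), ∃ σ : ∀ t, K (β t), σ s = k ∧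
        ∀ t ∈ Icc a b ∩ Metric.ball t₁ δ, IsParallelAt H K β (Icc a b) σ t) ∧
      ∀ (σ σ' : ∀ t, K (β t)) (S : Set ℝ), S.OrdConnected →
        S ⊆ Icc a b ∩ Metric.ball t₁ δ → (∀ t ∈ S, IsParallelAt H K β (Icc a b) σ t) →
        (∀ t ∈ S, IsParallelAt H K β (Icc a b) σ' t) →
        ∀ s ∈ S, σ s = σ' s → ∀ t ∈ S, σ t = σ' t := by
    intro t₁ ht₁
    obtain ⟨V, π, hV, hπ⟩ := exists_isProjectionChart hH hK hHK (β t₁)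
    obtain ⟨δ, hδ, Θ, Ψ, -, hprop, hgood, hex⟩ := hπ.exists_local_parallel hβ.lt hβ.contMDiffOn
      hβ.velocity_mem ht₁ (mem_chart_source E (β t₁)) hV
    refine ⟨δ, hδ, hex, fun σ σ' S hS hSU hσ hσ' s hs h t ht => ?_⟩
    have h1 := hβ.eq_of_isPropagator hπ inter_subset_left hgood hprop hS hSU hσ hs ht
    have h2 := hβ.eq_of_isPropagator hπ inter_subset_left hgood hprop hS hSU hσ' hs ht
    rw [h] at h1
    have h3 := Function.LeftInverse.injective (hprop.right_inv t (hSU ht)) (h1.symm.trans h2)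
    exact Subtype.ext (fibreCoord_injective (hgood t (hSU ht)).1 h3)
  choose! δ hδ hδex hδun using hloc
  obtain ⟨ε, hε, hε'⟩ := lebesgue_number_lemma_of_metric (s := Icc a b) (ι := Icc a b)
    (c := fun i => Metric.ball (i : ℝ) (δ i)) isCompact_Icc (fun i => Metric.isOpen_ball)
    (fun t ht => mem_iUnion.2 ⟨⟨t, ht⟩, Metric.mem_ball_self (hδ t ht)⟩)
  refine ⟨ε, hε, fun s hs k => ?_, fun t₁ ht₁ σ σ' S hS hSU => ?_⟩
  · obtain ⟨i, hi⟩ := hε' s hs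
    obtain ⟨σ, h1, h2⟩ := hδex i i.2 s ⟨hs, hi (Metric.mem_ball_self hε)⟩ k
    exact ⟨σ, h1, fun t ht => h2 t ⟨ht.1, hi ht.2⟩⟩
  · obtain ⟨i, hi⟩ := hε' t₁ ht₁
    exact hδun i i.2 σ σ' S hS (hSU.trans (inter_subset_inter_right _ hi))

variable [FiniteDimensional ℝ E] (hβ : IsHorizontalPath H β a b)
    (hH : IsSmoothSubbundle H) (hK : IsSmoothSubbundle K) (hHK : ∀ p, IsCompl (H p) (K p))
include hβ hH hK hHK

theorem isParallel_unique {σ σ' : ∀ t : ℝ, K (β t)} (hσ : IsParallel H K β (Icc a b) σ)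
    (hσ' : IsParallel H K β (Icc a b) σ') {s t : ℝ} (hs : s ∈ Icc a b) (ht : t ∈ Icc a b)
    (h : σ s = σ' s) : σ t = σ' t := by
  obtain ⟨δ, hδ, -, hun⟩ := hβ.exists_local hH hK hHK
  exact eq_of_local_uniqueness (V := fun t => K (β t)) (P := IsParallelAt H K β (Icc a b)) hδ hun
    ordConnected_Icc Subset.rfl (isParallel_iff.1 hσ) (isParallel_iff.1 hσ') hs ht h

theorem exists_isParallel {s : ℝ} (hs : s ∈ Icc a b) (k : K (β s)) :
    ∃ σ : ∀ t : ℝ, K (β t), IsParallel H K β (Icc a b) σ ∧ σ s = k := by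
  obtain ⟨δ, hδ, hex, hun⟩ := hβ.exists_local hH hK hHK
  obtain ⟨σ, h1, h2⟩ := exists_of_local_existence (V := fun t => K (β t))
    (P := IsParallelAt H K β (Icc a b)) hδ
    (fun σ σ' t ht => hβ.isParallelAt_congr hH hK hHK ht) hex hun hs k
  exact ⟨σ, isParallel_iff.2 h2, h1⟩

/-- By uniqueness, the section selected by choice in the definition may be replaced by any parallel
section. -/
theorem parallelTransport_eq {σ : ∀ t : ℝ, K (β t)} (hσ : IsParallel H K β (Icc a b) σ) {s t : ℝ}
    (hs : s ∈ Icc a b) (ht : t ∈ Icc a b) :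
    parallelTransport H K β (Icc a b) s t (σ s) = σ t := by
  have h : ∃ τ : ∀ r : ℝ, K (β r), IsParallel H K β (Icc a b) τ ∧ τ s = σ s := ⟨σ, hσ, rfl⟩
  rw [parallelTransport, dif_pos h]
  exact hβ.isParallel_unique hH hK hHK h.choose_spec.1 hσ hs ht h.choose_spec.2

theorem parallelTransport_trans {r s t : ℝ} (hr : r ∈ Icc a b) (hs : s ∈ Icc a b)
    (ht : t ∈ Icc a b) (k : K (β r)) :
    parallelTransport H K β (Icc a b) s t (parallelTransport H K β (Icc a b) r s k) =
      parallelTransport H K β (Icc a b) r t k := by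
  obtain ⟨σ, hσ, rfl⟩ := hβ.exists_isParallel hH hK hHK hr k
  rw [hβ.parallelTransport_eq hH hK hHK hσ hr hs, hβ.parallelTransport_eq hH hK hHK hσ hs ht,
    hβ.parallelTransport_eq hH hK hHK hσ hr ht]

theorem parallelTransport_self {t : ℝ} (ht : t ∈ Icc a b) (k : K (β t)) :
    parallelTransport H K β (Icc a b) t t k = k := by
  obtain ⟨σ, hσ, rfl⟩ := hβ.exists_isParallel hH hK hHK ht k
  exact hβ.parallelTransport_eq hH hK hHK hσ ht ht

theorem isParallel_add_smul {σ σ' : ∀ t : ℝ, K (β t)} (hσ : IsParallel H K β (Icc a b) σ)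
    (hσ' : IsParallel H K β (Icc a b) σ') (c : ℝ) :
    IsParallel H K β (Icc a b) fun t => c • σ t + σ' t := by
  rw [isParallel_iff] at *
  intro t ht
  obtain ⟨V, π, hV, hπ⟩ := exists_isProjectionChart hH hK hHK (β t)
  have hp : β t ∈ (chartAt E (β t)).source := mem_chart_source E (β t)
  have h1 := (hβ.isParallelAt_iff hπ ht hp hV).1 (hσ t ht)
  have h2 := (hβ.isParallelAt_iff hπ ht hp hV).1 (hσ' t ht)
  rw [hβ.isParallelAt_iff hπ ht hp hV]
  have h3 : ∀ s, fibreCoord (β t) (β s)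
      ((c • σ s + σ' s : K (β s)) : TangentSpace 𝓘(ℝ, E) (β s)) =
      c • fibreCoord (β t) (β s) (σ s : TangentSpace 𝓘(ℝ, E) (β s)) +
        fibreCoord (β t) (β s) (σ' s : TangentSpace 𝓘(ℝ, E) (β s)) := fun s => by
    rw [Submodule.coe_add, Submodule.coe_smul, map_add, map_smul]
  simp only [h3]
  rw [map_add, map_smul]
  exact (h1.const_smul c).add h2

/-- The parallel transport as a linear map. -/
theorem exists_parallelTransport_linear {s t : ℝ} (hs : s ∈ Icc a b) (ht : t ∈ Icc a b) :
    ∃ L : K (β s) →ₗ[ℝ] K (β t), ∀ k, L k = parallelTransport H K β (Icc a b) s t k := by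
  have key : ∀ (c : ℝ) (k k' : K (β s)), parallelTransport H K β (Icc a b) s t (c • k + k') =
      c • parallelTransport H K β (Icc a b) s t k + parallelTransport H K β (Icc a b) s t k' := by
    intro c k k'
    obtain ⟨σ, hσ, rfl⟩ := hβ.exists_isParallel hH hK hHK hs k
    obtain ⟨σ', hσ', rfl⟩ := hβ.exists_isParallel hH hK hHK hs k'
    rw [hβ.parallelTransport_eq hH hK hHK hσ hs ht, hβ.parallelTransport_eq hH hK hHK hσ' hs ht]
    exact hβ.parallelTransport_eq hH hK hHK (hβ.isParallel_add_smul hH hK hHK hσ hσ' c) hs ht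
  have key0 : parallelTransport H K β (Icc a b) s t 0 = 0 := by
    have := key 1 0 0
    simpa using this
  refine ⟨⟨⟨parallelTransport H K β (Icc a b) s t, fun k k' => ?_⟩, fun c k => ?_⟩, fun k => rfl⟩
  · simpa using key 1 k k'
  · simpa [key0] using key c k 0

end IsHorizontalPath

end

/-! ### Lie brackets and the curvature in a chart -/

section

variable {E : Type*} [NormedAddCommGroup E] [NormedSpace ℝ E]
  {M : Type*} [TopologicalSpace M] [ChartedSpace E M] [IsManifold 𝓘(ℝ, E) ∞ M]
  {H K : ∀ p : M, Submodule ℝ (TangentSpace 𝓘(ℝ, E) p)}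

/-- A local section with constant coefficients in a frame, cut off by a bump function. It guarantees
that `curvature` takes its meaningful branch on `H`. -/
theorem exists_isSmoothSectionOf [FiniteDimensional ℝ E] [T2Space M] (hH : IsSmoothSubbundle H)
    {p : M} {u : TangentSpace 𝓘(ℝ, E) p} (hu : u ∈ H p) :
    ∃ X : ∀ q : M, TangentSpace 𝓘(ℝ, E) q, IsSmoothSectionOf H X ∧ X p = u := by
  obtain ⟨k, e, U, hU, he, heH⟩ := hH p
  obtain ⟨U', hU', ho, hpU⟩ := mem_nhds_iff.1 hU
  rw [← (heH p (hU' hpU)).2, Submodule.mem_span_range_iff_exists_fun] at hu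
  obtain ⟨c, rfl⟩ := hu
  obtain ⟨f, -, hf⟩ := (SmoothBumpFunction.nhds_basis_tsupport (I := 𝓘(ℝ, E)) p).mem_iff.1
    (ho.mem_nhds hpU)
  have hs : ContMDiffOn 𝓘(ℝ, E) 𝓘(ℝ, E).tangent ∞
      (fun q => (⟨q, ∑ i, c i • e i q⟩ : TangentBundle 𝓘(ℝ, E) M)) U' :=
    ContMDiffOn.sum_section fun i _ => ContMDiffOn.const_smul_section ((he i).mono hU')
  refine ⟨fun q => f q • ∑ i, c i • e i q, ⟨?_, fun q => ?_⟩, ?_⟩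
  · exact ContMDiffOn.smul_section_of_tsupport f.contMDiff.contMDiffOn ho hf hs
  · by_cases hq : q ∈ U'
    · refine Submodule.smul_mem _ _ (Submodule.sum_mem _ fun i _ => Submodule.smul_mem _ _ ?_)
      rw [← (heH q (hU' hq)).2]
      exact Submodule.subset_span (mem_range_self i)
    · have : f q = 0 := image_eq_zero_of_notMem_tsupport fun h => hq (hf h)
      have h0 : f q • ∑ i, c i • e i q = 0 := by rw [this, zero_smul]
      exact (congrArg (· ∈ H q) h0).mpr (zero_mem (H q))
  · simp

/-- Reading a field in a chart is pulling it back, so naturality of the bracket reduces it to the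
bracket in `E`. -/
theorem mpullback_extChartAt_symm {p₀ : M} (X : ∀ q : M, TangentSpace 𝓘(ℝ, E) q) {y : E}
    (hy : y ∈ (extChartAt 𝓘(ℝ, E) p₀).target) :
    VectorField.mpullback 𝓘(ℝ, E) 𝓘(ℝ, E) (extChartAt 𝓘(ℝ, E) p₀).symm X y =
      fieldCoord p₀ X y := by
  have hs : (extChartAt 𝓘(ℝ, E) p₀).symm y ∈ (chartAt E p₀).source := by
    simpa using (extChartAt 𝓘(ℝ, E) p₀).map_target hy
  have h1 := mfderiv_extChartAt_comp_mfderivWithin_extChartAt_symm hy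
  have h2 := mfderivWithin_extChartAt_symm_comp_mfderiv_extChartAt hy
  have hr : range 𝓘(ℝ, E) = univ := by simp
  rw [hr, mfderivWithin_univ] at h1 h2
  rw [VectorField.mpullback_apply, fieldCoord, fibreCoord_eq_mfderiv hs,
    ContinuousLinearMap.inverse_eq h2 h1]
  rfl

theorem mlieBracket_eq_lieBracket (X Y : ∀ x : E, TangentSpace 𝓘(ℝ, E) x) (x : E) :
    VectorField.mlieBracket 𝓘(ℝ, E) X Y x = VectorField.lieBracket ℝ X Y x := by
  rw [← VectorField.mlieBracketWithin_univ, VectorField.mlieBracketWithin_eq_lieBracketWithin]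
  exact congrFun VectorField.lieBracketWithin_univ x

/-- The Lie bracket, read in a chart. -/
theorem fibreCoord_mlieBracket [CompleteSpace E] {p₀ p : M} (hp : p ∈ (chartAt E p₀).source)
    {X Y : ∀ q : M, TangentSpace 𝓘(ℝ, E) q}
    (hX : ContMDiffAt 𝓘(ℝ, E) 𝓘(ℝ, E).tangent ∞
      (fun q => (⟨q, X q⟩ : TangentBundle 𝓘(ℝ, E) M)) p)
    (hY : ContMDiffAt 𝓘(ℝ, E) 𝓘(ℝ, E).tangent ∞
      (fun q => (⟨q, Y q⟩ : TangentBundle 𝓘(ℝ, E) M)) p) :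
    fibreCoord p₀ p (VectorField.mlieBracket 𝓘(ℝ, E) X Y p) =
      fderiv ℝ (fieldCoord p₀ Y) (extChartAt 𝓘(ℝ, E) p₀ p) (fibreCoord p₀ p (X p)) -
        fderiv ℝ (fieldCoord p₀ X) (extChartAt 𝓘(ℝ, E) p₀ p) (fibreCoord p₀ p (Y p)) := by
  have hx : extChartAt 𝓘(ℝ, E) p₀ p ∈ (extChartAt 𝓘(ℝ, E) p₀).target :=
    (extChartAt 𝓘(ℝ, E) p₀).map_source (by simpa using hp)
  have hinv : (extChartAt 𝓘(ℝ, E) p₀).symm (extChartAt 𝓘(ℝ, E) p₀ p) = p :=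
    (extChartAt 𝓘(ℝ, E) p₀).left_inv (by simpa using hp)
  have hev : ∀ Z : ∀ q : M, TangentSpace 𝓘(ℝ, E) q,
      VectorField.mpullback 𝓘(ℝ, E) 𝓘(ℝ, E) (extChartAt 𝓘(ℝ, E) p₀).symm Z
        =ᶠ[𝓝 (extChartAt 𝓘(ℝ, E) p₀ p)] fieldCoord p₀ Z := fun Z => by
    filter_upwards [(isOpen_extChartAt_target p₀).mem_nhds hx] with y hy
      using mpullback_extChartAt_symm Z hy
  have hf : ContMDiffAt 𝓘(ℝ, E) 𝓘(ℝ, E) ∞ (extChartAt 𝓘(ℝ, E) p₀).symm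
      (extChartAt 𝓘(ℝ, E) p₀ p) :=
    (contMDiffOn_extChartAt_symm p₀).contMDiffAt ((isOpen_extChartAt_target p₀).mem_nhds hx)
  have h2 : minSmoothness ℝ 2 ≤ ∞ := by
    rw [minSmoothness_of_isRCLikeNormedField]
    exact WithTop.coe_le_coe.2 (le_top : (2 : ℕ∞) ≤ ⊤)
  have : IsManifold 𝓘(ℝ, E) (minSmoothness ℝ 2) M := IsManifold.of_le h2
  have key := VectorField.mpullback_mlieBracket (V := X) (W := Y)
    (hinv.symm ▸ hX.mdifferentiableAt (by simp)) (hinv.symm ▸ hY.mdifferentiableAt (by simp)) hf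
    h2
  have key' : fibreCoord p₀ p (VectorField.mlieBracket 𝓘(ℝ, E) X Y p) =
      VectorField.lieBracket ℝ (fieldCoord p₀ X) (fieldCoord p₀ Y)
        (extChartAt 𝓘(ℝ, E) p₀ p) := by
    refine (fieldCoord_extChartAt _ hp).symm.trans
      ((mpullback_extChartAt_symm _ hx).symm.trans (key.trans ?_))
    refine ((hev X).mlieBracket_vectorField_eq (hev Y)).trans ?_
    exact mlieBracket_eq_lieBracket _ _ _
  rw [key', VectorField.lieBracket, fieldCoord_extChartAt X hp, fieldCoord_extChartAt Y hp]

/-- The class of `v` modulo `H` depends on the projection of its coordinates only. -/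
theorem IsKernelChart.mkQ_eq_mkQ_iff {p₀ p : M} {V : Set E} {π : E → E →L[ℝ] E}
    (h : IsKernelChart H p₀ V π) (hp : p ∈ (chartAt E p₀).source)
    (hV : extChartAt 𝓘(ℝ, E) p₀ p ∈ V) (v w : TangentSpace 𝓘(ℝ, E) p) :
    (H p).mkQ v = (H p).mkQ w ↔ π (extChartAt 𝓘(ℝ, E) p₀ p) (fibreCoord p₀ p v) =
      π (extChartAt 𝓘(ℝ, E) p₀ p) (fibreCoord p₀ p w) := by
  rw [Submodule.mkQ_apply, Submodule.mkQ_apply, Submodule.Quotient.eq, h.mem_iff p hp hV,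
    map_sub, map_sub, sub_eq_zero]

/-- Derivative of `π X = 0`. It trades derivatives of `X` for values of `X`, which makes the bracket
modulo `H` tensorial. -/
theorem IsKernelChart.apply_fderiv_fieldCoord {p₀ p : M} {V : Set E} {π : E → E →L[ℝ] E}
    (h : IsKernelChart H p₀ V π) (hp : p ∈ (chartAt E p₀).source)
    (hV : extChartAt 𝓘(ℝ, E) p₀ p ∈ V) {X : ∀ q : M, TangentSpace 𝓘(ℝ, E) q}
    (hX : IsSmoothSectionOf H X) (v : E) :
    π (extChartAt 𝓘(ℝ, E) p₀ p) (fderiv ℝ (fieldCoord p₀ X) (extChartAt 𝓘(ℝ, E) p₀ p) v) =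
      -fderiv ℝ π (extChartAt 𝓘(ℝ, E) p₀ p) v (fibreCoord p₀ p (X p)) := by
  have hd : HasFDerivAt (fieldCoord p₀ X) (fderiv ℝ (fieldCoord p₀ X) (extChartAt 𝓘(ℝ, E) p₀ p))
      (extChartAt 𝓘(ℝ, E) p₀ p) :=
    ((contDiffAt_fieldCoord (h.subset hV) (hX.1 _)).differentiableAt (by simp)).hasFDerivAt
  have hz : (fun y => π y (fieldCoord p₀ X y)) =ᶠ[𝓝 (extChartAt 𝓘(ℝ, E) p₀ p)] fun _ => 0 := by
    filter_upwards [h.isOpen.mem_nhds hV] with y hy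
    have hs : (extChartAt 𝓘(ℝ, E) p₀).symm y ∈ (chartAt E p₀).source := by
      simpa using (extChartAt 𝓘(ℝ, E) p₀).map_target (h.subset hy)
    have hr := (extChartAt 𝓘(ℝ, E) p₀).right_inv (h.subset hy)
    have := (h.mem_iff _ hs (by rwa [hr]) _).1 (hX.2 _)
    rwa [hr] at this
  have h1 := ((h.hasFDerivAt hV).clm_apply hd).unique
    ((hasFDerivAt_const (0 : E) _).congr_of_eventuallyEq hz)
  have h2 := congrArg (fun L : E →L[ℝ] E => L v) h1
  rw [fieldCoord_extChartAt X hp] at h2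
  exact eq_neg_of_add_eq_zero_left h2

/-- The curvature of `H`, read in a chart. -/
theorem IsProjectionChart.curvature_eq [FiniteDimensional ℝ E] [T2Space M] {p₀ p : M} {V : Set E}
    {π : E → E →L[ℝ] E} (h : IsProjectionChart H K p₀ V π) (hH : IsSmoothSubbundle H)
    (hp : p ∈ (chartAt E p₀).source) (hV : extChartAt 𝓘(ℝ, E) p₀ p ∈ V)
    {u v : TangentSpace 𝓘(ℝ, E) p} (hu : u ∈ H p) (hv : v ∈ H p) :
    curvature H p u v = (H p).mkQ (fibreCoordSymm p₀ p
      (fderiv ℝ π (extChartAt 𝓘(ℝ, E) p₀ p) (fibreCoord p₀ p v) (fibreCoord p₀ p u) -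
        fderiv ℝ π (extChartAt 𝓘(ℝ, E) p₀ p) (fibreCoord p₀ p u) (fibreCoord p₀ p v))) := by
  have hidem : ∀ v, ∀ y ∈ H p, π (extChartAt 𝓘(ℝ, E) p₀ p)
      (fderiv ℝ π (extChartAt 𝓘(ℝ, E) p₀ p) v (fibreCoord p₀ p y)) =
        fderiv ℝ π (extChartAt 𝓘(ℝ, E) p₀ p) v (fibreCoord p₀ p y) := by
    intro v y hy
    have := h.fderiv_idem hV v (fibreCoord p₀ p y)
    rwa [(h.left.mem_iff p hp hV y).1 hy, map_zero, zero_add] at this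
  obtain ⟨X, hX, hXu⟩ := exists_isSmoothSectionOf hH hu
  obtain ⟨Y, hY, hYv⟩ := exists_isSmoothSectionOf hH hv
  have hex : ∃ XY : (∀ q : M, TangentSpace 𝓘(ℝ, E) q) × (∀ q : M, TangentSpace 𝓘(ℝ, E) q),
      IsSmoothSectionOf H XY.1 ∧ IsSmoothSectionOf H XY.2 ∧ XY.1 p = u ∧ XY.2 p = v :=
    ⟨(X, Y), hX, hY, hXu, hYv⟩
  rw [curvature, dif_pos hex]
  -- The sections picked by choice need not be `X` and `Y`; only their values at `p` enter the
  -- computation.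
  obtain ⟨hX', hY', hXu', hYv'⟩ := hex.choose_spec
  rw [h.left.mkQ_eq_mkQ_iff hp hV, fibreCoord_mlieBracket hp (hX'.1 p) (hY'.1 p),
    fibreCoord_fibreCoordSymm hp, map_sub, h.left.apply_fderiv_fieldCoord hp hV hX',
    h.left.apply_fderiv_fieldCoord hp hV hY', hXu', hYv', map_sub,
    hidem _ u hu, hidem _ v hv]
  abel

end

/-! ### The operator `D` in a chart -/

section

section Postcomposition

variable {F Q : Type*} [NormedAddCommGroup F] [NormedSpace ℝ F]
  [AddCommGroup Q] [Module ℝ Q] [TopologicalSpace Q]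

/-- The target, later a quotient `T_p M / H_p`, is given a topology but no norm, so the remainder is
estimated in the sense of topological vector spaces. -/
theorem hasFDerivWithinAt_clm_comp {f : ℝ → F} {f' : ℝ →L[ℝ] F} {s : Set ℝ} {t : ℝ}
    (L : F →L[ℝ] Q) (hf : HasFDerivWithinAt f f' s t) :
    HasFDerivWithinAt (fun r => L (f r)) (L.comp f') s t := by
  refine HasFDerivAtFilter.of_isLittleOTVS ?_
  refine ((L.isBigOTVS_comp (f := fun p : ℝ × ℝ => f p.1 - f p.2 - f' (p.1 - p.2))
    (l := 𝓝[s] t ×ˢ pure t)).trans_isLittleOTVS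
    (HasFDerivAtFilter.isLittleOTVS hf)).congr_left fun p => ?_
  simp

theorem derivWithin_eq_of_eventuallyEq_clm_comp [IsTopologicalAddGroup Q] [ContinuousSMul ℝ Q]
    [T2Space Q] {f : ℝ → F} {f' : F} {φ : ℝ → Q} {s : Set ℝ} {t : ℝ} (L : F →L[ℝ] Q)
    (hs : UniqueDiffWithinAt ℝ s t) (ht : t ∈ s) (hf : HasDerivWithinAt f f' s t)
    (h : φ =ᶠ[𝓝[s] t] fun r => L (f r)) :
    DifferentiableWithinAt ℝ φ s t ∧ derivWithin φ s t = L f' := by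
  have h1 := (hasFDerivWithinAt_clm_comp L hf.hasFDerivWithinAt).congr_of_eventuallyEq h
    (h.self_of_nhdsWithin ht)
  refine ⟨h1.differentiableWithinAt, ?_⟩
  rw [derivWithin, h1.fderivWithin hs]
  simp

end Postcomposition

variable {E : Type*} [NormedAddCommGroup E] [NormedSpace ℝ E]
  {M : Type*} [TopologicalSpace M] [ChartedSpace E M] [IsManifold 𝓘(ℝ, E) ∞ M]
  {H K : ∀ p : M, Submodule ℝ (TangentSpace 𝓘(ℝ, E) p)}

/-- Subspaces are closed in finite dimension. The Hausdorff property makes derivatives in the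
quotient unique. -/
theorem t2Space_quotient [FiniteDimensional ℝ E]
    (H : ∀ p : M, Submodule ℝ (TangentSpace 𝓘(ℝ, E) p)) (p : M) :
    T2Space (TangentSpace 𝓘(ℝ, E) p ⧸ H p) := by
  have h1 : FiniteDimensional ℝ (TangentSpace 𝓘(ℝ, E) p) := inferInstanceAs (FiniteDimensional ℝ E)
  have h2 : T2Space (TangentSpace 𝓘(ℝ, E) p) := inferInstanceAs (T2Space E)
  have h3 : IsClosed (H p : Set (TangentSpace 𝓘(ℝ, E) p)) := Submodule.closed_of_finiteDimensional _
  have h4 := Submodule.t3_quotient_of_isClosed (H p)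
  infer_instance

namespace IsHorizontalPath

variable {β : ℝ → M} {a b : ℝ}

/-- In a chart, the transported class is the image, under a fixed linear map, of a differentiable
curve. -/
theorem exists_transportedClass_eq [FiniteDimensional ℝ E] (hβ : IsHorizontalPath H β a b)
    (hH : IsSmoothSubbundle H) (hK : IsSmoothSubbundle K) (hHK : ∀ p, IsCompl (H p) (K p))
    {p₀ : M} {V : Set E} {π : E → E →L[ℝ] E} (h : IsProjectionChart H K p₀ V π) {t₀ t₁ : ℝ}
    (ht₀ : t₀ ∈ Icc a b) (ht₁ : t₁ ∈ Icc a b) (hp : β t₁ ∈ (chartAt E p₀).source)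
    (hV : extChartAt 𝓘(ℝ, E) p₀ (β t₁) ∈ V) :
    ∃ (L : E →L[ℝ] TangentSpace 𝓘(ℝ, E) (β t₀) ⧸ H (β t₀)) (Ψ : ℝ → E →L[ℝ] E),
      Ψ t₁ = ContinuousLinearMap.id ℝ E ∧
      HasDerivWithinAt Ψ (-connectionCoeff π (extChartAt 𝓘(ℝ, E) p₀ (β t₁))
        (speedCoord p₀ β (Icc a b) t₁)) (Icc a b) t₁ ∧
      (∀ w, quotientTransport hHK β (Icc a b) t₀ t₁ (L w) =
        (H (β t₁)).mkQ (fibreCoordSymm p₀ (β t₁) w)) ∧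
      ∀ X : ∀ t : ℝ, TangentSpace 𝓘(ℝ, E) (β t),
        transportedClass hHK β (Icc a b) t₀ X =ᶠ[𝓝[Icc a b] t₁] fun t =>
          L (Ψ t (π (extChartAt 𝓘(ℝ, E) p₀ (β t)) (fibreCoord p₀ (β t) (X t)))) := by
  obtain ⟨δ, hδ, Θ, Ψ, hΨ, hprop, hgood, -⟩ := h.exists_local_parallel hβ.lt hβ.contMDiffOn
    hβ.velocity_mem ht₁ hp hV
  obtain ⟨T, hT⟩ := hβ.exists_parallelTransport_linear hH hK hHK ht₁ ht₀
  -- From coordinates at `t₁`: project to `K`, transport to `t₀`, reduce modulo `H`. All dependence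
  -- on `t₀` is confined to this fixed map, which transport back to `t₁` undoes.
  set L₀ : E →ₗ[ℝ] TangentSpace 𝓘(ℝ, E) (β t₀) ⧸ H (β t₀) :=
    ((H (β t₀)).quotientEquivOfIsCompl (K (β t₀)) (hHK (β t₀))).symm.toLinearMap ∘ₗ T ∘ₗ
      (K (β t₁)).projectionOnto (H (β t₁)) (hHK (β t₁)).symm ∘ₗ
      (fibreCoordSymm p₀ (β t₁)).toLinearMap with hL₀
  have hL₀a : ∀ w, L₀ w = ((H (β t₀)).quotientEquivOfIsCompl (K (β t₀)) (hHK (β t₀))).symm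
      (parallelTransport H K β (Icc a b) t₁ t₀
        ((K (β t₁)).projectionOnto (H (β t₁)) (hHK (β t₁)).symm
          (fibreCoordSymm p₀ (β t₁) w))) := fun w => by rw [← hT]; rfl
  have ht₁U : t₁ ∈ Icc a b ∩ Metric.ball t₁ δ := ⟨ht₁, Metric.mem_ball_self hδ⟩
  refine ⟨⟨L₀, LinearMap.continuous_of_finiteDimensional L₀⟩, Ψ, hΨ, ?_, fun w => ?_, fun X => ?_⟩
  · refine (hprop.hasDerivWithinAt_inv t₁ ht₁U).congr_deriv ?_
    rw [hΨ]
    rfl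
  · change quotientTransport hHK β (Icc a b) t₀ t₁ (L₀ w) = _
    rw [hL₀a, quotientTransport, LinearEquiv.apply_symm_apply,
      hβ.parallelTransport_trans hH hK hHK ht₁ ht₀ ht₁, hβ.parallelTransport_self hH hK hHK ht₁]
    exact ((H (β t₁)).quotientEquivOfIsCompl (K (β t₁)) (hHK (β t₁))).symm_apply_apply
      ((H (β t₁)).mkQ (fibreCoordSymm p₀ (β t₁) w))
  · filter_upwards [inter_mem_nhdsWithin (Icc a b) (Metric.ball_mem_nhds t₁ hδ)] with t ht
    change _ = L₀ _
    obtain ⟨σ, hσ, hσt⟩ := hβ.exists_isParallel hH hK hHK ht.1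
      ((K (β t)).projectionOnto (H (β t)) (hHK (β t)).symm (X t))
    have hord : (Icc a b ∩ Metric.ball t₁ δ).OrdConnected := by
      rw [Real.ball_eq_Ioo]; exact ordConnected_Icc.inter ordConnected_Ioo
    -- `Ψ` is constant along the parallel section through the `K`-component of `X t`, and it is the
    -- identity at `t₁`; so it computes transport from `t` to `t₁`.
    have h1 := hβ.eq_of_isPropagator h inter_subset_left hgood hprop hord Subset.rfl
      (fun s hs => isParallel_iff.1 hσ s hs.1) ht ht₁U
    rw [hΨ, hσt] at h1
    rw [h.apply_fibreCoord hHK (hgood t ht).1 (hgood t ht).2, h1, hL₀a]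
    have h2 : fibreCoordSymm p₀ (β t₁) (ContinuousLinearMap.id ℝ E
        (fibreCoord p₀ (β t₁) (σ t₁ : TangentSpace 𝓘(ℝ, E) (β t₁)))) = σ t₁ :=
      fibreCoordSymm_fibreCoord hp _
    rw [h2, Submodule.projectionOnto_apply_left, hβ.parallelTransport_eq hH hK hHK hσ ht₁ ht₀,
      ← hβ.parallelTransport_eq hH hK hHK hσ ht.1 ht₀, hσt]
    rfl

/-- The operator `D`, read in a chart. -/
theorem variationOperator_eq [FiniteDimensional ℝ E] [T2Space M] (hβ : IsHorizontalPath H β a b)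
    (hH : IsSmoothSubbundle H) (hK : IsSmoothSubbundle K) (hHK : ∀ p, IsCompl (H p) (K p))
    {p₀ : M} {V : Set E} {π : E → E →L[ℝ] E} (h : IsProjectionChart H K p₀ V π) {t₀ t₁ : ℝ}
    (ht₀ : t₀ ∈ Icc a b) (ht₁ : t₁ ∈ Icc a b) (hp : β t₁ ∈ (chartAt E p₀).source)
    (hV : extChartAt 𝓘(ℝ, E) p₀ (β t₁) ∈ V) {X : ∀ t : ℝ, TangentSpace 𝓘(ℝ, E) (β t)} {X' : E}
    (hX : HasDerivWithinAt (fun t => fibreCoord p₀ (β t) (X t)) X' (Icc a b) t₁) :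
    DifferentiableWithinAt ℝ (transportedClass hHK β (Icc a b) t₀ X) (Icc a b) t₁ ∧
      variationOperator hHK β (Icc a b) t₀ X t₁ = (H (β t₁)).mkQ (fibreCoordSymm p₀ (β t₁)
        (X' + fderiv ℝ π (extChartAt 𝓘(ℝ, E) p₀ (β t₁)) (fibreCoord p₀ (β t₁) (X t₁))
          (speedCoord p₀ β (Icc a b) t₁))) := by
  obtain ⟨L, Ψ, hΨ, hΨd, hL, hLX⟩ := hβ.exists_transportedClass_eq hH hK hHK h ht₀ ht₁ hp hV
  set x : ℝ → E := fun t => extChartAt 𝓘(ℝ, E) p₀ (β t) with hx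
  set v : E := speedCoord p₀ β (Icc a b) t₁ with hv
  set ξ : ℝ → E := fun t => fibreCoord p₀ (β t) (X t) with hξ
  have hxd : HasDerivWithinAt x v (Icc a b) t₁ :=
    hasDerivWithinAt_extChartAt_comp ((hβ.contMDiffOn t₁ ht₁).mdifferentiableWithinAt (by simp)) hp
  have hπd : HasDerivWithinAt (fun t => π (x t)) (fderiv ℝ π (x t₁) v) (Icc a b) t₁ :=
    (h.left.hasFDerivAt hV).comp_hasDerivWithinAt t₁ hxd
  -- Product rule for `Ψ (π ξ)`, the transported class before the fixed map `L` is applied.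
  have hd := hΨd.clm_apply (hπd.clm_apply hX)
  have := t2Space_quotient H (β t₀)
  obtain ⟨h1, h2⟩ := derivWithin_eq_of_eventuallyEq_clm_comp L (uniqueDiffOn_Icc hβ.lt t₁ ht₁) ht₁
    hd (hLX X)
  refine ⟨h1, ?_⟩
  have hu : (H (β t₁)).projection (K (β t₁)) (hHK (β t₁)) (X t₁) ∈ H (β t₁) :=
    ((H (β t₁)).projectionOnto (K (β t₁)) (hHK (β t₁)) (X t₁)).2
  have huc : fibreCoord p₀ (β t₁) ((H (β t₁)).projection (K (β t₁)) (hHK (β t₁)) (X t₁)) =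
      ξ t₁ - π (x t₁) (ξ t₁) := by
    have e : (H (β t₁)).projection (K (β t₁)) (hHK (β t₁)) (X t₁) =
        X t₁ - (K (β t₁)).projectionOnto (H (β t₁)) (hHK (β t₁)).symm (X t₁) :=
      eq_sub_of_add_eq (Submodule.projection_add_projection_eq_self (hHK (β t₁)) (X t₁))
    exact (congrArg (fibreCoord p₀ (β t₁)) e).trans ((map_sub _ _ _).trans
      (congrArg _ (h.apply_fibreCoord hHK hp hV (X t₁)).symm))
  have hvc : fibreCoord p₀ (β t₁) (velocity β (Icc a b) t₁) = v := rfl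
  rw [variationOperator, h2, hL, h.curvature_eq hH hp hV hu (hβ.velocity_mem t₁ ht₁), huc, hvc,
    ← map_sub, ← map_sub, h.left.mkQ_eq_mkQ_iff hp hV, fibreCoord_fibreCoordSymm hp,
    fibreCoord_fibreCoordSymm hp, hΨ]
  -- The terms `Dπ(v) ξ`, `Dπ(v) π ξ` and `Dπ(π ξ) v` of the covariant derivative cancel against the
  -- curvature of `(1 - π) ξ ∧ v`; only `Dπ(ξ) v` survives beside `π ξ'`.
  have e : (-connectionCoeff π (x t₁) v) (π (x t₁) (ξ t₁)) +
      ContinuousLinearMap.id ℝ E (fderiv ℝ π (x t₁) v (ξ t₁) + π (x t₁) X') -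
      (fderiv ℝ π (x t₁) v (ξ t₁ - π (x t₁) (ξ t₁)) -
        fderiv ℝ π (x t₁) (ξ t₁ - π (x t₁) (ξ t₁)) v) =
      π (x t₁) X' + fderiv ℝ π (x t₁) (ξ t₁) v := by
    rw [neg_apply, connectionCoeff_apply, ContinuousLinearMap.id_apply, map_sub, map_sub,
      sub_apply]
    abel
  refine (congrArg (π (x t₁)) e).trans ?_
  rw [map_add, map_add, h.left.idem _ hV]

end IsHorizontalPath

theorem contDiffWithinAt_fibreCoord {p₀ : M} {β : ℝ → M} {J : Set ℝ}
    {X : ∀ t : ℝ, TangentSpace 𝓘(ℝ, E) (β t)} {t : ℝ}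
    (hX : ContMDiffWithinAt 𝓘(ℝ, ℝ) 𝓘(ℝ, E).tangent ∞
      (fun t => (⟨β t, X t⟩ : TangentBundle 𝓘(ℝ, E) M)) J t)
    (hp : β t ∈ (chartAt E p₀).source) :
    ContDiffWithinAt ℝ ∞ (fun t => fibreCoord p₀ (β t) (X t)) J t :=
  contDiff_snd.contDiffAt.comp_contDiffWithinAt
    (f := fun t => tangentCoord p₀ (⟨β t, X t⟩ : TangentBundle 𝓘(ℝ, E) M)) t
    ((contMDiffAt_tangentCoord hp).comp_contMDiffWithinAt t hX).contDiffWithinAt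

end

/-! ### Smoothness of `D X` and independence of the complement -/

section

variable {E : Type*} [NormedAddCommGroup E] [NormedSpace ℝ E]
  {M : Type*} [TopologicalSpace M] [ChartedSpace E M] [IsManifold 𝓘(ℝ, E) ∞ M]
  {H K : ∀ p : M, Submodule ℝ (TangentSpace 𝓘(ℝ, E) p)}

/-- `y - ρ y` lies in the kernel of `ρ`, which is also that of `ρ'`. -/
theorem IsKernelChart.apply_apply {p₀ : M} {V V' : Set E} {ρ ρ' : E → E →L[ℝ] E}
    (h : IsKernelChart H p₀ V ρ) (h' : IsKernelChart H p₀ V' ρ') {x : E} (hx : x ∈ V)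
    (hx' : x ∈ V') (y : E) : ρ' x (ρ x y) = ρ' x y := by
  have hs : (extChartAt 𝓘(ℝ, E) p₀).symm x ∈ (chartAt E p₀).source := by
    simpa using (extChartAt 𝓘(ℝ, E) p₀).map_target (h.subset hx)
  have hr := (extChartAt 𝓘(ℝ, E) p₀).right_inv (h.subset hx)
  have h1 := h.mem_iff _ hs (by rwa [hr]) (fibreCoordSymm p₀ _ (y - ρ x y))
  have h2 := h'.mem_iff _ hs (by rwa [hr]) (fibreCoordSymm p₀ _ (y - ρ x y))
  rw [hr, fibreCoord_fibreCoordSymm hs, map_sub] at h1 h2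
  exact (sub_eq_zero.1 ((map_sub _ _ _).symm.trans
    (h2.1 (h1.2 (by rw [map_sub, h.idem x hx, sub_self]))))).symm

/-- Derivative of `ρ' ρ = ρ'` at a vector `v` killed by `ρ`, so that the term `Dρ'(u) ρ v` drops
out. This is where tangency of the path to `H` removes the dependence on `K`. -/
theorem IsKernelChart.apply_fderiv_eq {p₀ : M} {V V' : Set E} {ρ ρ' : E → E →L[ℝ] E}
    (h : IsKernelChart H p₀ V ρ) (h' : IsKernelChart H p₀ V' ρ') {x : E} (hx : x ∈ V)
    (hx' : x ∈ V') {v : E} (hv : ρ x v = 0) (u : E) :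
    ρ' x (fderiv ℝ ρ x u v) = fderiv ℝ ρ' x u v := by
  have h1 := (h'.hasFDerivAt hx').clm_apply
    ((h.hasFDerivAt hx).clm_apply (hasFDerivAt_const v x))
  have h2 := (h'.hasFDerivAt hx').clm_apply (hasFDerivAt_const v x)
  have h3 : (fun z => ρ' z (ρ z v)) =ᶠ[𝓝 x] fun z => ρ' z v := by
    filter_upwards [h.isOpen.mem_nhds hx, h'.isOpen.mem_nhds hx'] with z hz hz'
      using h.apply_apply h' hz hz' v
  have h4 := congrArg (fun L : E →L[ℝ] E => L u) (h1.unique (h2.congr_of_eventuallyEq h3))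
  simpa [hv] using h4

theorem tangentCoordSymm_extChartAt {p₀ p : M} (hp : p ∈ (chartAt E p₀).source) (w : E) :
    tangentCoordSymm p₀ (extChartAt 𝓘(ℝ, E) p₀ p, w) = ⟨p, fibreCoordSymm p₀ p w⟩ := by
  have h := tangentCoordSymm_tangentCoord
    (v := (⟨p, fibreCoordSymm p₀ p w⟩ : TangentBundle 𝓘(ℝ, E) M)) hp
  rwa [tangentCoord, fibreCoord_fibreCoordSymm hp] at h

namespace IsHorizontalPath

variable {β : ℝ → M} {a b : ℝ}

theorem hasDerivWithinAt_fibreCoord {p₀ : M} {X : ∀ t : ℝ, TangentSpace 𝓘(ℝ, E) (β t)} {t : ℝ}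
    (hX : IsSmoothAlong β (Icc a b) X) (ht : t ∈ Icc a b) (hp : β t ∈ (chartAt E p₀).source) :
    HasDerivWithinAt (fun t => fibreCoord p₀ (β t) (X t))
      (derivWithin (fun t => fibreCoord p₀ (β t) (X t)) (Icc a b) t) (Icc a b) t :=
  ((contDiffWithinAt_fibreCoord (hX t ht) hp).differentiableWithinAt (by simp)).hasDerivWithinAt

theorem isSmoothQuotientAlong_variationOperator [FiniteDimensional ℝ E] [T2Space M]
    (hβ : IsHorizontalPath H β a b)
    (hH : IsSmoothSubbundle H) (hK : IsSmoothSubbundle K) (hHK : ∀ p, IsCompl (H p) (K p))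
    {t₀ : ℝ} (ht₀ : t₀ ∈ Icc a b) {X : ∀ t : ℝ, TangentSpace 𝓘(ℝ, E) (β t)}
    (hX : IsSmoothAlong β (Icc a b) X) :
    IsSmoothQuotientAlong H β (Icc a b) (variationOperator hHK β (Icc a b) t₀ X) := by
  intro t₁ ht₁
  have hJ := uniqueDiffOn_Icc hβ.lt
  obtain ⟨V, π, hV, hπ⟩ := exists_isProjectionChart hH hK hHK (β t₁)
  obtain ⟨U, hU, hgood⟩ := mem_nhdsWithin_iff_exists_mem_nhds_inter.1
    (hπ.eventually_mem (hβ.contMDiffOn t₁ ht₁) (mem_chart_source E (β t₁)) hV)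
  set p₀ := β t₁
  -- The chart formula for `D X`, before reduction modulo `H`, is the required smooth local lift.
  set g : ℝ → E := fun t => derivWithin (fun t => fibreCoord p₀ (β t) (X t)) (Icc a b) t +
    fderiv ℝ π (extChartAt 𝓘(ℝ, E) p₀ (β t)) (fibreCoord p₀ (β t) (X t))
      (speedCoord p₀ β (Icc a b) t) with hg
  refine ⟨U, hU, fun t => fibreCoordSymm p₀ (β t) (g t), fun t ht => ?_, fun t ht => ?_⟩
  · obtain ⟨hpt, hVt⟩ := hgood ⟨ht.2, ht.1⟩
    have hξ := contDiffWithinAt_fibreCoord (hX t ht.1) hpt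
    have hgc : ContDiffWithinAt ℝ ∞ g (Icc a b) t :=
      (hξ.derivWithin hJ (by norm_cast) ht.1).add
        (((contDiffWithinAt_comp_extChartAt (hβ.contMDiffOn t ht.1) hpt
          (hπ.contDiffAt_fderiv hVt)).clm_apply hξ).clm_apply
            (contDiffWithinAt_speedCoord hJ hβ.contMDiffOn ht.1 hpt))
    have hc : ContMDiffWithinAt 𝓘(ℝ, ℝ) 𝓘(ℝ, E).tangent ∞
        (fun t => tangentCoordSymm p₀ (extChartAt 𝓘(ℝ, E) p₀ (β t), g t)) (Icc a b) t :=
      (contMDiffAt_tangentCoordSymm (z := (extChartAt 𝓘(ℝ, E) p₀ (β t), g t))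
        ((extChartAt 𝓘(ℝ, E) p₀).map_source (by simpa using hpt))).comp_contMDiffWithinAt t
        ((contDiffWithinAt_extChartAt_comp (hβ.contMDiffOn t ht.1) hpt).prodMk
          hgc).contMDiffWithinAt
    refine (hc.mono inter_subset_left).congr (fun s hs => ?_) ?_
    · exact (tangentCoordSymm_extChartAt (hgood ⟨hs.2, hs.1⟩).1 _).symm
    · exact (tangentCoordSymm_extChartAt hpt _).symm
  · obtain ⟨hpt, hVt⟩ := hgood ⟨ht.2, ht.1⟩
    exact (hβ.variationOperator_eq hH hK hHK hπ ht₀ ht.1 hpt hVt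
      (hasDerivWithinAt_fibreCoord hX ht.1 hpt)).2.symm

theorem differentiableWithinAt_transportedClass [FiniteDimensional ℝ E] [T2Space M]
    (hβ : IsHorizontalPath H β a b)
    (hH : IsSmoothSubbundle H) (hK : IsSmoothSubbundle K) (hHK : ∀ p, IsCompl (H p) (K p))
    {t₀ t : ℝ} (ht₀ : t₀ ∈ Icc a b) (ht : t ∈ Icc a b)
    {X : ∀ t : ℝ, TangentSpace 𝓘(ℝ, E) (β t)} (hX : IsSmoothAlong β (Icc a b) X) :
    DifferentiableWithinAt ℝ (transportedClass hHK β (Icc a b) t₀ X) (Icc a b) t := by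
  obtain ⟨V, π, hV, hπ⟩ := exists_isProjectionChart hH hK hHK (β t)
  have hp : β t ∈ (chartAt E (β t)).source := mem_chart_source E (β t)
  exact (hβ.variationOperator_eq hH hK hHK hπ ht₀ ht hp hV
    (hasDerivWithinAt_fibreCoord hX ht hp)).1

theorem variationOperator_eq_variationOperator [FiniteDimensional ℝ E] [T2Space M]
    (hβ : IsHorizontalPath H β a b) (hH : IsSmoothSubbundle H)
    {K₁ K₂ : ∀ p : M, Submodule ℝ (TangentSpace 𝓘(ℝ, E) p)}
    (hK₁ : IsSmoothSubbundle K₁) (hK₂ : IsSmoothSubbundle K₂)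
    (h₁ : ∀ p, IsCompl (H p) (K₁ p)) (h₂ : ∀ p, IsCompl (H p) (K₂ p))
    {t₁ t₂ t : ℝ} (ht₁ : t₁ ∈ Icc a b) (ht₂ : t₂ ∈ Icc a b) (ht : t ∈ Icc a b)
    {X : ∀ t : ℝ, TangentSpace 𝓘(ℝ, E) (β t)} (hX : IsSmoothAlong β (Icc a b) X) :
    variationOperator h₁ β (Icc a b) t₁ X t = variationOperator h₂ β (Icc a b) t₂ X t := by
  obtain ⟨V₁, π₁, hV₁, hπ₁⟩ := exists_isProjectionChart hH hK₁ h₁ (β t)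
  obtain ⟨V₂, π₂, hV₂, hπ₂⟩ := exists_isProjectionChart hH hK₂ h₂ (β t)
  have hp : β t ∈ (chartAt E (β t)).source := mem_chart_source E (β t)
  have hd := hasDerivWithinAt_fibreCoord hX ht hp
  have hv₁ := (hπ₁.left.mem_iff _ hp hV₁ _).1 (hβ.velocity_mem t ht)
  have hv₂ := (hπ₂.left.mem_iff _ hp hV₂ _).1 (hβ.velocity_mem t ht)
  rw [(hβ.variationOperator_eq hH hK₁ h₁ hπ₁ ht₁ ht hp hV₁ hd).2,
    (hβ.variationOperator_eq hH hK₂ h₂ hπ₂ ht₂ ht hp hV₂ hd).2,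
    hπ₂.left.mkQ_eq_mkQ_iff hp hV₂, fibreCoord_fibreCoordSymm hp, fibreCoord_fibreCoordSymm hp,
    map_add, map_add]
  congr 1
  -- After applying `π₂`, both correction terms equal `Dπ₂(ξ) v`: compare `π₁` with `π₂`, then `π₂`
  -- with itself.
  exact (hπ₁.left.apply_fderiv_eq hπ₂.left hV₁ hV₂ hv₁ _).trans
    (hπ₂.left.apply_fderiv_eq hπ₂.left hV₂ hV₂ hv₂ _).symm

end IsHorizontalPath
end

end SubbundleCurvature

end

open SubbundleCurvature in
theorem theorem11
    {E : Type*} [NormedAddCommGroup E] [NormedSpace ℝ E] [FiniteDimensional ℝ E]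
    {M : Type*} [TopologicalSpace M] [T2Space M] [ChartedSpace E M] [IsManifold 𝓘(ℝ, E) ∞ M]
    (H : ∀ p : M, Submodule ℝ (TangentSpace 𝓘(ℝ, E) p)) (hH : IsSmoothSubbundle H)
    (a b : ℝ) (hab : a < b) (β : ℝ → M)
    (hβ : ContMDiffOn 𝓘(ℝ, ℝ) 𝓘(ℝ, E) ∞ β (Icc a b))
    (hβH : ∀ t ∈ Icc a b, velocity β (Icc a b) t ∈ H (β t)) :
    -- the parallel transports are well defined
    (∀ K : ∀ p : M, Submodule ℝ (TangentSpace 𝓘(ℝ, E) p), IsSmoothSubbundle K →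
      (∀ p, IsCompl (H p) (K p)) → ∀ s ∈ Icc a b, ∀ k : K (β s),
        ∃ σ : ∀ t : ℝ, K (β t), IsParallel H K β (Icc a b) σ ∧ σ s = k ∧
          ∀ σ' : ∀ t : ℝ, K (β t), IsParallel H K β (Icc a b) σ' → σ' s = k →
            ∀ t ∈ Icc a b, σ' t = σ t) ∧
    -- the derivative exists and `D` maps smooth sections to smooth sections
    (∀ K : ∀ p : M, Submodule ℝ (TangentSpace 𝓘(ℝ, E) p), IsSmoothSubbundle K →
      ∀ hHK : ∀ p, IsCompl (H p) (K p), ∀ t₀ ∈ Icc a b,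
        ∀ X : ∀ t : ℝ, TangentSpace 𝓘(ℝ, E) (β t), IsSmoothAlong β (Icc a b) X →
          (∀ t ∈ Icc a b,
            DifferentiableWithinAt ℝ (transportedClass hHK β (Icc a b) t₀ X) (Icc a b) t) ∧
          IsSmoothQuotientAlong H β (Icc a b) (variationOperator hHK β (Icc a b) t₀ X)) ∧
    -- `D` depends neither on the base point nor on the complement
    (∀ K₁ K₂ : ∀ p : M, Submodule ℝ (TangentSpace 𝓘(ℝ, E) p),
      IsSmoothSubbundle K₁ → IsSmoothSubbundle K₂ →
      ∀ (h₁ : ∀ p, IsCompl (H p) (K₁ p)) (h₂ : ∀ p, IsCompl (H p) (K₂ p)),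
        ∀ t₁ ∈ Icc a b, ∀ t₂ ∈ Icc a b,
          ∀ X : ∀ t : ℝ, TangentSpace 𝓘(ℝ, E) (β t), IsSmoothAlong β (Icc a b) X →
            ∀ t ∈ Icc a b,
              variationOperator h₁ β (Icc a b) t₁ X t =
                variationOperator h₂ β (Icc a b) t₂ X t) := by
  have h : IsHorizontalPath H β a b := ⟨hab, hβ, hβH⟩
  refine ⟨fun K hK hHK s hs k => ?_, fun K hK hHK t₀ ht₀ X hX => ⟨fun t ht => ?_, ?_⟩,
    fun K₁ K₂ hK₁ hK₂ h₁ h₂ t₁ ht₁ t₂ ht₂ X hX t ht => ?_⟩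
  · obtain ⟨σ, hσ, hσs⟩ := h.exists_isParallel hH hK hHK hs k
    exact ⟨σ, hσ, hσs, fun σ' hσ' hσ's t ht =>
      h.isParallel_unique hH hK hHK hσ' hσ hs ht (hσ's.trans hσs.symm)⟩
  · exact h.differentiableWithinAt_transportedClass hH hK hHK ht₀ ht hX
  · exact h.isSmoothQuotientAlong_variationOperator hH hK hHK ht₀ hX
  · exact h.variationOperator_eq_variationOperator hH hK₁ hK₂ h₁ h₂ ht₁ ht₂ ht hX
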